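/- **Setting.** A *shuffle protocol* $\Pi=(\Pi_R,\Pi_A)$ with data universe $\mathcal X$, message space $\mathcal Y$ and output space $\mathcal O$ consists of a randomizer $\Pi_R:\mathcal X\to\mathcal Y^*$, which maps a user's datum to a random finite sequence of messages of arbitrary (possibly random) length, and a randomized analyzer $\Pi_A:\mathcal Y^*\to\mathcal O$. Both may depend on the intended number $n$ of users and on a public random string of arbitrary distribution. The shuffler $\Pi_S$ applies a uniformly random permutation to the concatenation of all users' messages; users randomize independently given the public string. On $x\in\mathcal X^n$ the protocol outputs $\Pi(x)=\Pi_A(\Pi_S(\Pi_R(x_1),\dots,\Pi_R(x_n)))$. A randomized algorithm $M$ on $\mathcal X^m$ is *$(\varepsilon,\delta)$-differentially private* if $\Pr[M(x)\in C]\le e^{\varepsilon}\Pr[M(x')\in C]+\delta$ for all $x,x'\in\mathcal X^m$ that differ in at most one row and all events $C$. For $\gamma\in(0,1]$, the protocol $\Pi$ is *$(\varepsilon,\delta,\gamma)$-robustly shuffle private* if for every intended number $n$ of users and every number $m$ of participating users with $\gamma n\le m\le n$, the map sending $(x_1,\dots,x_m)$ to the public random string together with $\Pi_S(\Pi_R(x_1),\dots,\Pi_R(x_m))$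 is $(\varepsilon,\delta)$-differentially private. A protocol with $\mathcal X=\{\pm1\}^d$ and $\mathcal O=\{1,\dots,d\}$ *solves $(\alpha,d)$-selection with sample complexity $n$* if for every probability distribution $\mathbf P$ on $\{\pm1\}^d$, run on $n$ independent samples from $\mathbf P$, it outputs $J$ such that, with probability at least $99/100$ (over the samples and the protocol), $\mathbb E_{X\sim\mathbf P}[X_J]\ge\max_j\mathbb E_{X\sim\mathbf P}[X_j]-\alpha$. **Theorem.** There are absolute constants $c,C>0$ such that the following holds for every integer $d\ge2$ and all reals $\alpha\in(0,\tfrac12)$, $\varepsilon>0$, $\delta\in[0,1]$ with $$\delta\log\frac d\delta\le c\,\frac{\alpha^2\varepsilon^2}{d}$$ (the left side being read as $0$ when $\delta=0$). If $\Pi$ is an $(\varepsilon,\delta,\tfrac13)$-robustly shuffle private protocol, with any number of messages per user, that solves $(\alpha,d)$-selection with sample complexity $n$, then $$n\ge C\,\frac{\sqrt d}{\alpha\varepsilon}.$$ -/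

import Mathlib

open MeasureTheory ProbabilityTheory
open scoped ENNReal

noncomputable section

/-! ### Finite sequences of messages as a measurable space -/

section MessageSequences

variable {Y : Type*} [MeasurableSpace Y]

/-- The σ-algebra on `Y^* = ⋃ₖ Y^k`: a set of finite sequences is measurable iff, for every `k`,
its part of length `k` is measurable in the product space `Y^k`. -/
instance listMeasurableSpace : MeasurableSpace (List Y) :=
  ⨅ k : ℕ, (MeasurableSpace.pi : MeasurableSpace (Fin k → Y)).map List.ofFn

lemma measurableSet_list_iff {s : Set (List Y)} :
    MeasurableSet s ↔ ∀ k : ℕ, MeasurableSet ((List.ofFn : (Fin k → Y) → List Y) ⁻¹' s) := by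
  simp [MeasurableSpace.measurableSet_iInf, MeasurableSpace.map_def]

lemma measurable_ofFn_list (k : ℕ) : Measurable (List.ofFn : (Fin k → Y) → List Y) :=
  fun _ hs => measurableSet_list_iff.1 hs k

lemma measurable_from_list {Z : Type*} [MeasurableSpace Z] {f : List Y → Z}
    (h : ∀ k : ℕ, Measurable fun u : Fin k → Y => f (List.ofFn u)) : Measurable f :=
  fun _ hs => measurableSet_list_iff.2 fun k => h k hs

lemma measurableEmbedding_ofFn_list (k : ℕ) :
    MeasurableEmbedding (List.ofFn : (Fin k → Y) → List Y) where
  injective := List.ofFn_injective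
  measurable := measurable_ofFn_list k
  measurableSet_image' := by
    intro s hs
    refine measurableSet_list_iff.2 fun j => ?_
    by_cases hjk : j = k
    · subst hjk
      rwa [Set.preimage_image_eq _ List.ofFn_injective]
    · have : (List.ofFn : (Fin j → Y) → List Y) ⁻¹' (List.ofFn '' s) = ∅ := by
        ext u
        simp only [Set.mem_preimage, Set.mem_image, Set.mem_empty_iff_false, iff_false, not_exists,
          not_and]
        intro v _ hv
        apply hjk
        simpa using (congrArg List.length hv).symm
      rw [this]
      exact MeasurableSet.empty

lemma measurable_append_list : Measurable fun p : List Y × List Y => p.1 ++ p.2 := by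
  intro s hs
  have key : (fun p : List Y × List Y => p.1 ++ p.2) ⁻¹' s =
      ⋃ (k : ℕ) (l : ℕ), Prod.map (List.ofFn : (Fin k → Y) → List Y)
        (List.ofFn : (Fin l → Y) → List Y) ''
          {q | List.ofFn (Fin.append q.1 q.2) ∈ s} := by
    ext ⟨a, b⟩
    simp only [Set.mem_preimage, Set.mem_iUnion, Set.mem_image, Set.mem_ofPred_eq, Prod.exists,
      Prod.map_apply, Prod.mk.injEq]
    constructor
    · intro h
      exact ⟨a.length, b.length, a.get, b.get, by simpa [List.ofFn_fin_append] using h, by simp⟩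
    · rintro ⟨k, l, u, v, h, rfl, rfl⟩
      simpa [List.ofFn_fin_append] using h
  rw [key]
  refine MeasurableSet.iUnion fun k => MeasurableSet.iUnion fun l => ?_
  refine ((measurableEmbedding_ofFn_list k).prodMap
    (measurableEmbedding_ofFn_list l)).measurableSet_image.2 ?_
  refine (?_ : Measurable fun q : (Fin k → Y) × (Fin l → Y) =>
    List.ofFn (Fin.append q.1 q.2)) hs
  refine (measurable_ofFn_list (k + l)).comp (measurable_pi_iff.2 fun i => ?_)
  refine Fin.addCases (fun i => ?_) (fun i => ?_) i
  · simpa [Function.comp_def] using (measurable_pi_apply i).comp measurable_fst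
  · simpa [Function.comp_def] using (measurable_pi_apply i).comp measurable_snd

/-! ### The shuffler -/

/-- The law of a uniformly random permutation of the entries of the sequence `l`. -/
def shuffleMeasure (l : List Y) : Measure (List Y) :=
  ((l.length.factorial : ℝ≥0∞))⁻¹ •
    ∑ σ : Equiv.Perm (Fin l.length), Measure.dirac (List.ofFn fun i => l.get (σ i))

lemma shuffleMeasure_ofFn {k : ℕ} (u : Fin k → Y) :
    shuffleMeasure (List.ofFn u) = ((k.factorial : ℝ≥0∞))⁻¹ •
      ∑ σ : Equiv.Perm (Fin k), Measure.dirac (List.ofFn fun i => u (σ i)) := by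
  have aux : ∀ (l : List Y) (k : ℕ) (h : l.length = k),
      shuffleMeasure l = ((k.factorial : ℝ≥0∞))⁻¹ •
        ∑ σ : Equiv.Perm (Fin k),
          Measure.dirac (List.ofFn fun i => l.get (Fin.cast h.symm (σ i))) := by
    intro l k h
    subst h
    rfl
  rw [aux (List.ofFn u) k (by simp)]
  simp

/-- The shuffler: it applies a uniformly random permutation to all messages. -/
def shuffler (Y : Type*) [MeasurableSpace Y] : Kernel (List Y) (List Y) where
  toFun := shuffleMeasure
  measurable' := by
    refine measurable_from_list fun k => ?_
    refine Measure.measurable_of_measurable_coe _ fun s hs => ?_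
    simp only [shuffleMeasure_ofFn, Measure.smul_apply, Measure.finsetSum_apply, smul_eq_mul]
    refine Measurable.const_mul (Finset.measurable_sum _ fun σ _ => ?_) _
    refine (Measure.measurable_coe hs).comp (Measure.measurable_dirac.comp ?_)
    exact (measurable_ofFn_list k).comp (measurable_pi_iff.2 fun i => measurable_pi_apply (σ i))

instance : IsMarkovKernel (shuffler Y) where
  isProbabilityMeasure l := by
    constructor
    change shuffleMeasure l Set.univ = 1
    simp only [shuffleMeasure, Measure.smul_apply, Measure.finsetSum_apply, measure_univ,
      Finset.sum_const, Finset.card_univ, Fintype.card_perm, Fintype.card_fin, nsmul_eq_mul,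
      mul_one, smul_eq_mul]
    exact ENNReal.inv_mul_cancel (by exact_mod_cast Nat.factorial_ne_zero _)
      (ENNReal.natCast_ne_top _)

end MessageSequences

/-! ### Differential privacy -/

/-- Two datasets are neighbors if they differ in at most one row. -/
def Neighbors {X : Type*} {m : ℕ} (x x' : Fin m → X) : Prop :=
  {i | x i ≠ x' i}.Subsingleton

/-- `(ε, δ)`-differential privacy of a randomized algorithm on datasets with `m` rows. -/
def IsDP {X Z : Type*} [MeasurableSpace X] [MeasurableSpace Z] {m : ℕ}
    (M : Kernel (Fin m → X) Z) (ε δ : ℝ) : Prop :=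
  ∀ x x' : Fin m → X, Neighbors x x' → ∀ C : Set Z, MeasurableSet C →
    M x C ≤ ENNReal.ofReal (Real.exp ε) * M x' C + ENNReal.ofReal δ

/-! ### Shuffle protocols -/

/-- A (multi-message) protocol in the shuffle model, with data universe `X`, public randomness in
`W`, messages in `Y` and outputs in `O`. Users and analyzer know the intended number `n` of users
and the public random string; each user sends a finite sequence of messages of arbitrary,
possibly random, length. -/
structure ShuffleProtocol (X W Y O : Type*) [MeasurableSpace X] [MeasurableSpace W]
    [MeasurableSpace Y] [MeasurableSpace O] where
  /-- law of the public randomness -/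
  coins : ℕ → Measure W
  /-- the local randomizer, run by each user on the public randomness and the user's own row -/
  randomizer : ℕ → Kernel (W × X) (List Y)
  /-- the analyzer, run on the public randomness and the shuffled messages -/
  analyzer : ℕ → Kernel (W × List Y) O
  isProbabilityMeasure_coins : ∀ n, IsProbabilityMeasure (coins n)
  isMarkovKernel_randomizer : ∀ n, IsMarkovKernel (randomizer n)
  isMarkovKernel_analyzer : ∀ n, IsMarkovKernel (analyzer n)

/-- Given the public randomness `w` and the rows `x 0, …, x (m - 1)` of `m` users, the law of the
concatenation of the message sequences that the users produce, independently of each other given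
`w`, with the local randomizer `R`. -/
def collectMessages {X W Y : Type*} [MeasurableSpace X] [MeasurableSpace W] [MeasurableSpace Y]
    (R : Kernel (W × X) (List Y)) : (m : ℕ) → Kernel (W × (Fin m → X)) (List Y)
  | 0 => Kernel.const _ (Measure.dirac [])
  | m + 1 =>
    ((R.comap (fun p : W × (Fin (m + 1) → X) => (p.1, p.2 0)) (by fun_prop)) ×ₖ
      ((collectMessages R m).comap
        (fun p : W × (Fin (m + 1) → X) => (p.1, fun i : Fin m => p.2 i.succ)) (by fun_prop))).map
      (fun q : List Y × List Y => q.1 ++ q.2)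

instance {X W Y : Type*} [MeasurableSpace X] [MeasurableSpace W] [MeasurableSpace Y]
    (R : Kernel (W × X) (List Y)) [IsMarkovKernel R] (m : ℕ) :
    IsMarkovKernel (collectMessages R m) := by
  induction m with
  | zero => unfold collectMessages; infer_instance
  | succ m ih =>
    unfold collectMessages
    exact Kernel.IsMarkovKernel.map _ measurable_append_list

namespace ShuffleProtocol

attribute [instance] isProbabilityMeasure_coins isMarkovKernel_randomizer isMarkovKernel_analyzer

variable {X W Y O : Type*} [MeasurableSpace X] [MeasurableSpace W] [MeasurableSpace Y]
  [MeasurableSpace O]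

/-- What an observer of the shuffler sees when `m` users follow the protocol for `n` intended
users: the public randomness together with the shuffled messages. -/
def view (Pr : ShuffleProtocol X W Y O) (n m : ℕ) : Kernel (Fin m → X) (W × List Y) :=
  Kernel.const (Fin m → X) (Pr.coins n) ⊗ₖ
    (shuffler Y ∘ₖ collectMessages (Pr.randomizer n) m).comap
      (fun p : (Fin m → X) × W => (p.2, p.1)) (by fun_prop)

instance (Pr : ShuffleProtocol X W Y O) (n m : ℕ) : IsMarkovKernel (Pr.view n m) := by
  unfold view
  infer_instance

/-- The honest execution of the protocol on a dataset with `n` rows. -/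
def output (Pr : ShuffleProtocol X W Y O) (n : ℕ) : Kernel (Fin n → X) O :=
  Pr.analyzer n ∘ₖ Pr.view n n

instance (Pr : ShuffleProtocol X W Y O) (n : ℕ) : IsMarkovKernel (Pr.output n) := by
  unfold output
  infer_instance

/-- `(ε, δ, γ)`-robust shuffle privacy: whenever at least a `γ` fraction of the `n` intended users
follow the protocol, what the shuffler reveals is `(ε, δ)`-differentially private. -/
def IsRobustlyPrivate (Pr : ShuffleProtocol X W Y O) (ε δ γ : ℝ) : Prop :=
  ∀ n m : ℕ, γ * n ≤ m → m ≤ n → IsDP (Pr.view n m) ε δ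

end ShuffleProtocol

/-! ### Selection -/

/-- Every subset of `ℤˣ = {1, -1}`, and hence of `{±1}^d`, is measurable. -/
instance : MeasurableSingletonClass ℤˣ where
  measurableSet_singleton u :=
    ⟨{(u : ℤ)}, MeasurableSet.singleton _, by ext v; simp [Units.ext_iff]⟩

/-- `M` solves `(α, d)`-selection with sample complexity `n`: for every distribution `P` on
`{±1}^d`, on `n` independent samples from `P` it outputs, with probability at least `99/100`, a
coordinate whose mean is within `α` of the largest mean. -/
def SolvesSelection {d n : ℕ} (M : Kernel (Fin n → Fin d → ℤˣ) (Fin d)) (α : ℝ) : Prop :=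
  ∀ P : Measure (Fin d → ℤˣ), IsProbabilityMeasure P →
    ENNReal.ofReal (99 / 100) ≤
      (M ∘ₘ Measure.pi fun _ : Fin n => P)
        {J | ∀ j, ∫ x, ((x j : ℤ) : ℝ) ∂P - α ≤ ∫ x, ((x J : ℤ) : ℝ) ∂P}

end

noncomputable section

/-! ### The shuffler and permutations -/

/-! The hard instances are product distributions with one coordinate `j` of mean `b / 2 > α` and all
others uniform, so a correct selector must output `j`. Such a sample is an equal mixture of a
uniform row and a row whose `j`-th mean is `b`. Hence the output law averages, over a binomial
number `k` of uniform rows, the hybrids with `k` uniform and `n - k` biased rows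
(`le_sum_choose_mul_hybridProb`).

Sum over `j` the probability that hybrid `k` outputs `j`. At `k = n` the hybrid does not depend on
`j`, so the sum is at most 1. Passing from `k` to `k + 1` makes one biased row uniform. The
remaining `n - k - 1` biased users can be simulated by whoever sees the messages of the other `k +
1` users, and that view is private by robustness as soon as `k + 1 ≥ n / 3`. The simulations differ
with `j`, so the resulting events need not be disjoint and their probabilities may add up to order
`d`.

What saves the argument is concentration: the change equals `b` times the average over uniform `x`
of `∑ⱼ xⱼ gⱼ`, evaluated on the view containing the row `x`. If the view were independent of `x`,
this would average to 0 with subgaussian fluctuations of order `√d`; privacy therefore keeps it at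
order `ε√d + δd` (`sum_integral_signedSum_le`). The hypothesis on `δ` absorbs the second term.

Hybrids with `k + 1 < n / 3` are bounded trivially by `d` and have small binomial weight. Altogether
a constant multiple of `d` is at most of order `n α ε √d`. -/

lemma List.Perm.exists_equiv_get {α : Type*} {l l' : List α} (h : l.Perm l') :
    ∃ e : Fin l.length ≃ Fin l'.length, ∀ i, l'.get (e i) = l.get i := by
  induction h with
  | nil => exact ⟨Equiv.refl _, fun _ => rfl⟩
  | @cons a l l' _ ih =>
    obtain ⟨e, he⟩ := ih
    refine ⟨(finSuccEquiv l.length).trans (e.optionCongr.trans (finSuccEquiv l'.length).symm),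
      fun i => ?_⟩
    refine Fin.cases ?_ (fun i => ?_) i
    · simp
    · simpa using he i
  | swap a b l =>
    refine ⟨Equiv.swap (0 : Fin (l.length + 2)) 1, fun i => ?_⟩
    refine Fin.cases ?_ (fun i => Fin.cases ?_ (fun i => ?_) i) i
    · simp [Equiv.swap_apply_left]
    · have : (Equiv.swap (0 : Fin (l.length + 2)) 1) (Fin.succ 0) = 0 := by simp
      rw [this]; simp
    · have : (Equiv.swap (0 : Fin (l.length + 2)) 1) i.succ.succ = i.succ.succ :=
        Equiv.swap_apply_of_ne_of_ne (Fin.succ_ne_zero _)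
          (by simp [Fin.ext_iff])
      rw [this]; simp
  | trans _ _ ih₁ ih₂ =>
    obtain ⟨e₁, h₁⟩ := ih₁
    obtain ⟨e₂, h₂⟩ := ih₂
    exact ⟨e₁.trans e₂, fun i => by simpa using (h₂ _).trans (h₁ i)⟩

section Shuffler

variable {Y : Type*} [MeasurableSpace Y]

/-- Composing a uniform permutation with a fixed one leaves it uniform. This makes the analyzer's
success probability a symmetric statistic of the messages. -/
lemma shuffleMeasure_eq_of_perm {l l' : List Y} (h : l.Perm l') :
    shuffleMeasure l = shuffleMeasure l' := by
  obtain ⟨e, he⟩ := h.exists_equiv_get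
  obtain ⟨k, u, rfl⟩ : ∃ (k : ℕ) (u : Fin k → Y), l = List.ofFn u :=
    ⟨_, l.get, (List.ofFn_get l).symm⟩
  obtain ⟨k', u', rfl⟩ : ∃ (k : ℕ) (u : Fin k → Y), l' = List.ofFn u :=
    ⟨_, l'.get, (List.ofFn_get l').symm⟩
  have hk : k = k' := by simpa using h.length_eq
  subst hk
  obtain ⟨σ, hσ⟩ : ∃ σ : Equiv.Perm (Fin k), ∀ i, u' (σ i) = u i := by
    refine ⟨(finCongr (by simp)).trans (e.trans (finCongr (by simp))), fun i => ?_⟩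
    have := he (Fin.cast (by simp) i)
    simp only [List.get_ofFn] at this
    exact this
  rw [shuffleMeasure_ofFn, shuffleMeasure_ofFn]
  congr 1
  refine Fintype.sum_equiv (Equiv.mulLeft σ) _ _ fun τ => ?_
  simp [← hσ]

/-- Symmetric statistics do not notice the shuffler, so later arguments can work with the unshuffled
messages. -/
lemma lintegral_shuffleMeasure_of_perm_invariant {g : List Y → ℝ≥0∞} (hg : Measurable g)
    (hinv : ∀ l l' : List Y, l.Perm l' → g l = g l') (l : List Y) :
    ∫⁻ l', g l' ∂(shuffler Y l) = g l := by
  have : ∀ l', l'.Perm l → g l' = g l := fun l' h => hinv _ _ h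
  change ∫⁻ l', g l' ∂(shuffleMeasure l) = g l
  have key : ∀ σ : Equiv.Perm (Fin l.length), g (List.ofFn fun i => l.get (σ i)) = g l := by
    intro σ
    refine hinv _ _ ?_
    have := Equiv.Perm.ofFn_comp_perm σ l.get
    rw [List.ofFn_get] at this
    exact this
  rw [shuffleMeasure, lintegral_smul_measure, lintegral_finsetSum_measure]
  simp only [lintegral_dirac' _ hg, key]
  simp only [Finset.sum_const, Finset.card_univ, Fintype.card_perm, Fintype.card_fin,
    nsmul_eq_mul, smul_eq_mul]
  rw [← mul_assoc, ENNReal.inv_mul_cancel (by exact_mod_cast Nat.factorial_ne_zero _)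
      (ENNReal.natCast_ne_top _), one_mul]

end Shuffler

/-! ### Messages of a list of users -/

section Messages

variable {X W Y : Type*} [MeasurableSpace X] [MeasurableSpace W] [MeasurableSpace Y]

/-- The law, given the public randomness `w`, of the concatenated messages of users whose rows are
listed in a list. -/
def listMessages (R : Kernel (W × X) (List Y)) (l : List X) : Kernel W (List Y) :=
  (collectMessages R l.length).comap (fun w => (w, l.get)) (by fun_prop)

instance (R : Kernel (W × X) (List Y)) [IsMarkovKernel R] (l : List X) :
    IsMarkovKernel (listMessages R l) := by
  unfold listMessages; infer_instance

lemma listMessages_ofFn (R : Kernel (W × X) (List Y)) {m : ℕ} (x : Fin m → X) (w : W) :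
    listMessages R (List.ofFn x) w = collectMessages R m (w, x) := by
  have aux : ∀ (l : List X) (k : ℕ) (h : l.length = k),
      listMessages R l w = collectMessages R k (w, fun i => l.get (Fin.cast h.symm i)) := by
    intro l k h
    subst h
    rfl
  rw [aux (List.ofFn x) m (by simp)]
  simp

lemma lintegral_listMessages_cons (R : Kernel (W × X) (List Y)) [IsMarkovKernel R] (w : W) (x : X)
    (xs : List X) {f : List Y → ℝ≥0∞} (hf : Measurable f) :
    ∫⁻ l, f l ∂(listMessages R (x :: xs) w) =
      ∫⁻ l₀, ∫⁻ l, f (l₀ ++ l) ∂(listMessages R xs w) ∂(R (w, x)) := by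
  have hf' : Measurable fun q : List Y × List Y => f (q.1 ++ q.2) := hf.comp measurable_append_list
  change ∫⁻ l, f l ∂(collectMessages R (xs.length + 1) (w, (x :: xs).get)) = _
  rw [collectMessages, Kernel.map_apply _ measurable_append_list,
    lintegral_map hf measurable_append_list, Kernel.lintegral_prod _ _ _ hf']
  rfl

lemma measurable_append_const_left (l₀ : List Y) : Measurable fun l : List Y => l₀ ++ l :=
  measurable_append_list.comp measurable_prodMk_left

/-- Users are independent given `w`, so exchanging two adjacent users is Tonelli's theorem followed
by the symmetry of `f`. This is what allows datasets to be treated as multisets. -/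
lemma lintegral_listMessages_perm (R : Kernel (W × X) (List Y)) [IsMarkovKernel R] (w : W)
    {xs xs' : List X} (h : xs.Perm xs') {f : List Y → ℝ≥0∞} (hf : Measurable f)
    (hinv : ∀ l l' : List Y, l.Perm l' → f l = f l') :
    ∫⁻ l, f l ∂(listMessages R xs w) = ∫⁻ l, f l ∂(listMessages R xs' w) := by
  induction h generalizing f with
  | nil => rfl
  | cons x _ ih =>
    rw [lintegral_listMessages_cons _ _ _ _ hf, lintegral_listMessages_cons _ _ _ _ hf]
    refine lintegral_congr fun l₀ => ih (hf.comp (measurable_append_const_left l₀))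
      fun l l' h => hinv _ _ (h.append_left l₀)
  | swap a b l =>
    have hg : ∀ l₀ : List Y, Measurable fun l => f (l₀ ++ l) := fun l₀ =>
      hf.comp (measurable_append_const_left l₀)
    rw [lintegral_listMessages_cons _ _ _ _ hf, lintegral_listMessages_cons _ _ _ _ hf]
    simp_rw [fun l₀ => lintegral_listMessages_cons R w a l (hg l₀),
      fun l₀ => lintegral_listMessages_cons R w b l (hg l₀)]
    rw [lintegral_lintegral_swap]
    · refine lintegral_congr fun l₁ => lintegral_congr fun l₀ => lintegral_congr fun l => ?_
      refine hinv _ _ ?_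
      rw [← List.append_assoc, ← List.append_assoc]
      exact List.perm_append_comm.append_right l
    · refine Measurable.aemeasurable ?_
      have : Measurable fun p : (List Y × List Y) × List Y => f (p.1.1 ++ (p.1.2 ++ p.2)) :=
        hf.comp (measurable_append_list.comp ((measurable_fst.comp measurable_fst).prodMk
          (measurable_append_list.comp ((measurable_snd.comp measurable_fst).prodMk
            measurable_snd))))
      exact this.lintegral_prod_right'
  | trans _ _ ih₁ ih₂ => exact (ih₁ hf hinv).trans (ih₂ hf hinv)

end Messages

/-! ### Adding random rows to a dataset -/

section SampleStep

variable {X : Type*} [Fintype X]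

/-- The operator that averages a function of a multiset over the insertion of an element drawn with
weights `p`. -/
def sampleStep (p : X → ℝ≥0∞) : Module.End ℝ≥0∞ (Multiset X → ℝ≥0∞) where
  toFun Ψ s := ∑ x, p x * Ψ (x ::ₘ s)
  map_add' Ψ Ψ' := by
    funext s
    simp [mul_add, Finset.sum_add_distrib]
  map_smul' c Ψ := by
    funext s
    simp [Finset.mul_sum, mul_left_comm]

lemma sampleStep_apply (p : X → ℝ≥0∞) (Ψ : Multiset X → ℝ≥0∞) (s : Multiset X) :
    sampleStep p Ψ s = ∑ x, p x * Ψ (x ::ₘ s) := rfl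

/-- Rows enter a multiset, so the order of insertion is irrelevant. Commutation is what makes the
binomial theorem available for mixtures of two row distributions. -/
lemma sampleStep_commute (p q : X → ℝ≥0∞) : Commute (sampleStep p) (sampleStep q) := by
  refine LinearMap.ext fun Ψ => funext fun s => ?_
  simp only [Module.End.mul_apply, sampleStep_apply, Finset.mul_sum]
  rw [Finset.sum_comm]
  refine Finset.sum_congr rfl fun x _ => Finset.sum_congr rfl fun y _ => ?_
  rw [Multiset.cons_swap, mul_left_comm]

/-- Averaging with total weight 1 preserves an additive error. The comparison is required only at
one cardinality because the privacy bound compares datasets of a fixed size. -/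
lemma sampleStep_pow_le {p : X → ℝ≥0∞} (hp : ∑ x, p x = 1) (D : ℝ≥0∞) (k r : ℕ)
    {Ψ Ψ' : Multiset X → ℝ≥0∞} (h : ∀ s, s.card = r + k → Ψ s ≤ Ψ' s + D) (s : Multiset X)
    (hs : s.card = r) : (sampleStep p ^ k) Ψ s ≤ (sampleStep p ^ k) Ψ' s + D := by
  induction k generalizing r s with
  | zero => simpa using h s hs
  | succ k ih =>
    simp only [pow_succ', Module.End.mul_apply, sampleStep_apply]
    calc ∑ x, p x * (sampleStep p ^ k) Ψ (x ::ₘ s)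
        ≤ ∑ x, p x * ((sampleStep p ^ k) Ψ' (x ::ₘ s) + D) := by
          gcongr with x
          exact ih (r + 1) (fun s hs => h s (by omega)) _ (by simp [hs])
      _ = _ := by simp [mul_add, Finset.sum_add_distrib, ← Finset.sum_mul, hp]

lemma sampleStep_pow_const {p : X → ℝ≥0∞} (hp : ∑ x, p x = 1) (c : ℝ≥0∞) (k : ℕ) :
    (sampleStep p ^ k) (fun _ => c) = fun _ => c := by
  induction k with
  | zero => simp
  | succ k ih =>
    rw [pow_succ', Module.End.mul_apply, ih]
    funext s
    simp [sampleStep_apply, ← Finset.sum_mul, hp]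

lemma sampleStep_pow_le_const {p : X → ℝ≥0∞} (hp : ∑ x, p x = 1) {c : ℝ≥0∞} (k : ℕ)
    {Ψ : Multiset X → ℝ≥0∞} (h : ∀ s, Ψ s ≤ c) (s : Multiset X) :
    (sampleStep p ^ k) Ψ s ≤ c := by
  have := sampleStep_pow_le hp 0 k _ (Ψ := Ψ) (Ψ' := fun _ => c) (fun s _ => by simpa using h s) s
    rfl
  simpa [sampleStep_pow_const hp] using this

lemma sampleStep_pow_eq_sum (p : X → ℝ≥0∞) (Ψ : Multiset X → ℝ≥0∞) (n : ℕ) (s : Multiset X) :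
    (sampleStep p ^ n) Ψ s = ∑ x : Fin n → X, (∏ i, p (x i)) * Ψ (↑(List.ofFn x) + s) := by
  induction n generalizing s with
  | zero => simp
  | succ n ih =>
    rw [pow_succ', Module.End.mul_apply, sampleStep_apply]
    simp_rw [ih, Finset.mul_sum]
    rw [← Fintype.sum_prod_type']
    refine Fintype.sum_equiv (Fin.consEquiv fun _ => X) _ _ fun q => ?_
    simp only [Fin.consEquiv, Equiv.coe_fn_mk, Fin.prod_univ_succ, Fin.cons_zero, Fin.cons_succ,
      List.ofFn_succ, mul_assoc, ← Multiset.cons_coe, Multiset.cons_add, Multiset.add_cons]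

lemma lintegral_pi_eq_sampleStep_pow [MeasurableSpace X] [MeasurableSingletonClass X]
    (P : Measure X) [IsProbabilityMeasure P] (Ψ : Multiset X → ℝ≥0∞) (n : ℕ) :
    ∫⁻ x : Fin n → X, Ψ ↑(List.ofFn x) ∂(Measure.pi fun _ => P) =
      (sampleStep (fun x => P {x}) ^ n) Ψ 0 := by
  rw [lintegral_fintype, sampleStep_pow_eq_sum]
  refine Finset.sum_congr rfl fun x _ => ?_
  rw [Measure.pi_singleton, mul_comm, add_zero]

lemma sampleStep_average_pow (p q : X → ℝ≥0∞) (Ψ : Multiset X → ℝ≥0∞) (n : ℕ) (s : Multiset X) :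
    (sampleStep (fun x => 2⁻¹ * (p x + q x)) ^ n) Ψ s =
      ∑ k ∈ Finset.range (n + 1), 2⁻¹ ^ n * n.choose k *
        (sampleStep p ^ k) ((sampleStep q ^ (n - k)) Ψ) s := by
  have h : sampleStep (fun x => 2⁻¹ * (p x + q x)) =
      (2⁻¹ : ℝ≥0∞) • (sampleStep p + sampleStep q) := by
    refine LinearMap.ext fun Ψ => funext fun s => ?_
    simp [sampleStep_apply, ← Finset.sum_add_distrib, Finset.mul_sum, add_mul, mul_add, mul_assoc]
  rw [h, smul_pow, (sampleStep_commute p q).add_pow]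
  simp only [LinearMap.smul_apply, Pi.smul_apply, LinearMap.sum_apply, Finset.sum_apply,
    smul_eq_mul, Finset.mul_sum]
  refine Finset.sum_congr rfl fun k _ => ?_
  rw [← nsmul_eq_mul', LinearMap.smul_apply, Pi.smul_apply, Module.End.mul_apply, nsmul_eq_mul,
    mul_assoc]

end SampleStep

/-! ### The view and the output as functions of the multiset of rows -/

namespace ShuffleProtocol

variable {X W Y O : Type*} [MeasurableSpace X] [MeasurableSpace W] [MeasurableSpace Y]
  [MeasurableSpace O]

lemma lintegral_view (Pr : ShuffleProtocol X W Y O) (n m : ℕ) (x : Fin m → X)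
    {g : W × List Y → ℝ≥0∞} (hg : Measurable g) :
    ∫⁻ z, g z ∂(Pr.view n m x) =
      ∫⁻ w, ∫⁻ l, ∫⁻ l', g (w, l') ∂(shuffler Y l)
        ∂(listMessages (Pr.randomizer n) (List.ofFn x) w) ∂(Pr.coins n) := by
  rw [view, Kernel.lintegral_compProd _ _ _ hg]
  simp only [Kernel.const_apply]
  refine lintegral_congr fun w => ?_
  rw [Kernel.comap_apply, Kernel.lintegral_comp (g := fun l => g (w, l)) _ _ _
    (hg.comp measurable_prodMk_left), listMessages_ofFn]

/-- The expectation of a statistic `g` of the public randomness and the messages of users with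
given rows. -/
def expectedStatistic (Pr : ShuffleProtocol X W Y O) (n : ℕ) (g : W × List Y → ℝ≥0∞)
    (xs : List X) : ℝ≥0∞ :=
  ∫⁻ w, ∫⁻ l, g (w, l) ∂(listMessages (Pr.randomizer n) xs w) ∂(Pr.coins n)

lemma expectedStatistic_perm (Pr : ShuffleProtocol X W Y O) (n : ℕ) {g : W × List Y → ℝ≥0∞}
    (hg : Measurable g) (hinv : ∀ w, ∀ l l' : List Y, l.Perm l' → g (w, l) = g (w, l'))
    {xs xs' : List X} (h : xs.Perm xs') :
    Pr.expectedStatistic n g xs = Pr.expectedStatistic n g xs' :=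
  lintegral_congr fun w =>
    lintegral_listMessages_perm _ w h (hg.comp measurable_prodMk_left) (hinv w)

lemma lintegral_view_of_perm_invariant (Pr : ShuffleProtocol X W Y O) (n m : ℕ) (x : Fin m → X)
    {g : W × List Y → ℝ≥0∞} (hg : Measurable g)
    (hinv : ∀ w, ∀ l l' : List Y, l.Perm l' → g (w, l) = g (w, l')) :
    ∫⁻ z, g z ∂(Pr.view n m x) = Pr.expectedStatistic n g (List.ofFn x) := by
  rw [lintegral_view Pr n m x hg, expectedStatistic]
  refine lintegral_congr fun w => lintegral_congr fun l => ?_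
  exact lintegral_shuffleMeasure_of_perm_invariant (hg.comp measurable_prodMk_left) (hinv w) l

/-- The probability that the analyzer's output lies in `s` after the messages are shuffled. -/
def analyzerProb (Pr : ShuffleProtocol X W Y O) (n : ℕ) (s : Set O) (p : W × List Y) : ℝ≥0∞ :=
  ∫⁻ l, Pr.analyzer n (p.1, l) s ∂(shuffler Y p.2)

lemma measurable_analyzerProb (Pr : ShuffleProtocol X W Y O) (n : ℕ) {s : Set O}
    (hs : MeasurableSet s) : Measurable (Pr.analyzerProb n s) := by
  have h : Measurable fun q : (W × List Y) × List Y => Pr.analyzer n (q.1.1, q.2) s :=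
    ((Pr.analyzer n).measurable_coe hs).comp (by fun_prop)
  exact Measurable.lintegral_kernel_prod_right'
    (κ := (shuffler Y).comap (Prod.snd : W × List Y → List Y) measurable_snd) h

lemma analyzerProb_perm (Pr : ShuffleProtocol X W Y O) (n : ℕ) (s : Set O) (w : W)
    (l l' : List Y) (h : l.Perm l') : Pr.analyzerProb n s (w, l) = Pr.analyzerProb n s (w, l') := by
  have : shuffler Y l = shuffler Y l' := shuffleMeasure_eq_of_perm h
  simp only [analyzerProb, this]

lemma analyzerProb_le_one (Pr : ShuffleProtocol X W Y O) (n : ℕ) (s : Set O) (p : W × List Y) :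
    Pr.analyzerProb n s p ≤ 1 := by
  calc Pr.analyzerProb n s p ≤ ∫⁻ _, 1 ∂(shuffler Y p.2) := lintegral_mono fun _ => prob_le_one
    _ = 1 := by simp

lemma output_apply_eq (Pr : ShuffleProtocol X W Y O) (n : ℕ) {s : Set O} (hs : MeasurableSet s)
    (x : Fin n → X) :
    Pr.output n x s = Pr.expectedStatistic n (Pr.analyzerProb n s) (List.ofFn x) := by
  rw [output, Kernel.comp_apply' _ _ _ hs,
    lintegral_view Pr n n x ((Pr.analyzer n).measurable_coe hs)]
  rfl

/-- The probability that the output lies in `s`, as a function of the multiset of rows. -/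
def outputProb (Pr : ShuffleProtocol X W Y O) (n : ℕ) {s : Set O} (hs : MeasurableSet s) :
    Multiset X → ℝ≥0∞ :=
  Quot.lift (Pr.expectedStatistic n (Pr.analyzerProb n s)) fun _ _ h =>
    Pr.expectedStatistic_perm n (Pr.measurable_analyzerProb n hs) (Pr.analyzerProb_perm n s) h

lemma outputProb_coe (Pr : ShuffleProtocol X W Y O) (n : ℕ) {s : Set O} (hs : MeasurableSet s)
    (l : List X) :
    Pr.outputProb n hs ↑l = Pr.expectedStatistic n (Pr.analyzerProb n s) l := rfl

lemma expectedStatistic_le_one (Pr : ShuffleProtocol X W Y O) (n : ℕ) {g : W × List Y → ℝ≥0∞}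
    (hg : ∀ z, g z ≤ 1) (xs : List X) : Pr.expectedStatistic n g xs ≤ 1 := by
  have := Pr.isProbabilityMeasure_coins n
  calc Pr.expectedStatistic n g xs
      ≤ ∫⁻ w, ∫⁻ _, 1 ∂(listMessages (Pr.randomizer n) xs w) ∂(Pr.coins n) :=
        lintegral_mono fun w => lintegral_mono fun l => hg _
    _ = 1 := by simp

lemma outputProb_le_one (Pr : ShuffleProtocol X W Y O) (n : ℕ) {s : Set O} (hs : MeasurableSet s)
    (t : Multiset X) : Pr.outputProb n hs t ≤ 1 := by
  induction t using Quot.inductionOn with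
  | h l => exact Pr.expectedStatistic_le_one n (Pr.analyzerProb_le_one n s) l

/-- Averaging `outputProb` over `r` additional random rows is the same as taking the expectation of
a statistic of the messages of the other users. -/
lemma exists_statistic_sampleStep_pow [Fintype X] (Pr : ShuffleProtocol X W Y O) (n : ℕ)
    {s : Set O} (hs : MeasurableSet s) {q : X → ℝ≥0∞} (hq : ∑ x, q x = 1) (r : ℕ) :
    ∃ g : W × List Y → ℝ≥0∞, Measurable g ∧ (∀ z, g z ≤ 1) ∧
      (∀ w, ∀ l l' : List Y, l.Perm l' → g (w, l) = g (w, l')) ∧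
      ∀ l : List X, (sampleStep q ^ r) (Pr.outputProb n hs) ↑l = Pr.expectedStatistic n g l := by
  induction r with
  | zero =>
    exact ⟨Pr.analyzerProb n s, Pr.measurable_analyzerProb n hs, Pr.analyzerProb_le_one n s,
      Pr.analyzerProb_perm n s, fun l => by simp [outputProb_coe]⟩
  | succ r ih =>
    obtain ⟨g, hg, hg1, hinv, h⟩ := ih
    have happ : Measurable fun t : (W × List Y) × List Y => g (t.1.1, t.2 ++ t.1.2) :=
      hg.comp ((measurable_fst.comp measurable_fst).prodMk (measurable_append_list.comp
        (measurable_snd.prodMk (measurable_snd.comp measurable_fst))))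
    have hmeas : ∀ x, Measurable fun z : W × List Y =>
        ∫⁻ l', g (z.1, l' ++ z.2) ∂(Pr.randomizer n (z.1, x)) := fun x =>
      Measurable.lintegral_kernel_prod_right'
        (κ := (Pr.randomizer n).comap (fun z : W × List Y => (z.1, x)) (by fun_prop)) happ
    -- The new statistic simulates one more user: it draws a row from `q`, runs the randomizer on
    -- the same public string and adds the messages to those observed.
    refine ⟨fun z => ∑ x, q x * ∫⁻ l', g (z.1, l' ++ z.2) ∂(Pr.randomizer n (z.1, x)), ?_, ?_, ?_,
      ?_⟩
    · exact Finset.measurable_sum _ fun x _ => (hmeas x).const_mul _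
    · intro z
      calc ∑ x, q x * ∫⁻ l', g (z.1, l' ++ z.2) ∂(Pr.randomizer n (z.1, x))
          ≤ ∑ x, q x * ∫⁻ _, 1 ∂(Pr.randomizer n (z.1, x)) := by
            gcongr
            exact hg1 _
        _ = 1 := by simp [hq]
    · intro w l l' hl
      refine Finset.sum_congr rfl fun x _ => ?_
      congr 1
      exact lintegral_congr fun l₀ => hinv _ _ _ (hl.append_left l₀)
    · intro l
      rw [pow_succ', Module.End.mul_apply, sampleStep_apply]
      simp_rw [Multiset.cons_coe, h, expectedStatistic]
      have e₁ : ∀ w, ∀ x, Measurable fun l =>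
          ∫⁻ l', g (w, l' ++ l) ∂(Pr.randomizer n (w, x)) := fun w x =>
        (hmeas x).comp measurable_prodMk_left
      have e₂ : ∀ w, ∫⁻ l', ∑ x, q x * ∫⁻ l'', g (w, l'' ++ l') ∂(Pr.randomizer n (w, x))
            ∂(listMessages (Pr.randomizer n) l w) =
          ∑ x, q x * ∫⁻ l', ∫⁻ l'', g (w, l'' ++ l') ∂(Pr.randomizer n (w, x))
            ∂(listMessages (Pr.randomizer n) l w) := by
        intro w
        rw [lintegral_finsetSum _ fun x _ => (e₁ w x).const_mul _]
        exact Finset.sum_congr rfl fun x _ => lintegral_const_mul _ (e₁ w x)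
      have e₃ : ∀ x, Measurable fun w => ∫⁻ l', ∫⁻ l'', g (w, l'' ++ l')
          ∂(Pr.randomizer n (w, x)) ∂(listMessages (Pr.randomizer n) l w) := fun x =>
        Measurable.lintegral_kernel_prod_right' (κ := listMessages (Pr.randomizer n) l) (hmeas x)
      simp_rw [e₂]
      rw [lintegral_finsetSum _ fun x _ => (e₃ x).const_mul _]
      refine Finset.sum_congr rfl fun x _ => ?_
      rw [lintegral_const_mul _ (e₃ x)]
      congr 1
      refine lintegral_congr fun w => ?_
      rw [lintegral_listMessages_cons (f := fun l => g (w, l)) _ _ _ _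
          (hg.comp measurable_prodMk_left),
        lintegral_lintegral_swap]
      refine Measurable.aemeasurable ?_
      exact hg.comp (measurable_const.prodMk measurable_append_list)

end ShuffleProtocol

/-! ### Signed sums over the hypercube -/

section Hypercube

variable {d : ℕ}

/-- The value `±1` of a sign as a real number. -/
abbrev signVal (u : ℤˣ) : ℝ := ((u : ℤ) : ℝ)

/-- Flipping the `j`-th sign is an involution of the cube that negates each term. -/
lemma sum_signVal_mul (j : Fin d) {f : (Fin d → ℤˣ) → ℝ}
    (hf : ∀ x, f (Function.update x j (-x j)) = f x) : ∑ x : Fin d → ℤˣ, signVal (x j) * f x = 0 := by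
  have hinv : Function.Involutive fun x : Fin d → ℤˣ => Function.update x j (-x j) := by
    intro x
    simp
  have h := Fintype.sum_equiv hinv.toPerm (fun x : Fin d → ℤˣ => signVal (x j) * f x)
    (fun x => -(signVal (x j) * f x)) fun x => by
      simp [Function.Involutive.toPerm, hf, signVal]
  rw [Finset.sum_neg_distrib] at h
  linarith

lemma sum_signVal (j : Fin d) : ∑ x : Fin d → ℤˣ, signVal (x j) = 0 := by
  simpa using sum_signVal_mul j (f := fun _ => 1) fun _ => rfl

lemma signVal_mul_self (u : ℤˣ) : signVal u * signVal u = 1 := by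
  rcases Int.units_eq_one_or u with rfl | rfl <;> simp [signVal]

lemma abs_signVal (u : ℤˣ) : |signVal u| = 1 := by
  rcases Int.units_eq_one_or u with rfl | rfl <;> simp [signVal]

lemma sum_signVal_mul_signVal (i j : Fin d) :
    ∑ x : Fin d → ℤˣ, signVal (x i) * signVal (x j) = if i = j then 2 ^ d else 0 := by
  split_ifs with h
  · subst h
    simp [signVal_mul_self]
  · exact sum_signVal_mul i fun x => by simp [Function.update_of_ne (Ne.symm h)]

/-- The signed sum `∑ⱼ xⱼ gⱼ`. -/
def signedSum (x : Fin d → ℤˣ) (g : Fin d → ℝ) : ℝ := ∑ j, signVal (x j) * g j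

lemma sum_signedSum (g : Fin d → ℝ) : ∑ x, signedSum x g = 0 := by
  simp only [signedSum]
  rw [Finset.sum_comm]
  simp [← Finset.sum_mul, sum_signVal]

lemma abs_signedSum_le {g : Fin d → ℝ} (h0 : ∀ j, 0 ≤ g j) (h1 : ∀ j, g j ≤ 1)
    (x : Fin d → ℤˣ) : |signedSum x g| ≤ d := by
  calc |signedSum x g| ≤ ∑ j, |signVal (x j) * g j| := Finset.abs_sum_le_sum_abs _ _
    _ ≤ ∑ _j : Fin d, (1 : ℝ) := by
        gcongr with j
        rw [abs_mul, abs_signVal, one_mul, abs_of_nonneg (h0 j)]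
        exact h1 j
    _ = d := by simp

/-- The subgaussian estimate: the exponential sum factors over coordinates into hyperbolic cosines,
and `cosh s ≤ exp (s² / 2)`. -/
lemma sum_exp_signedSum_le {g : Fin d → ℝ} (h0 : ∀ j, 0 ≤ g j) (h1 : ∀ j, g j ≤ 1) (t : ℝ) :
    ∑ x, Real.exp (t * signedSum x g) ≤ 2 ^ d * Real.exp (t ^ 2 * d / 2) := by
  have key : ∑ x, Real.exp (t * signedSum x g) = ∏ j, (2 * Real.cosh (t * g j)) := by
    have : ∀ j, 2 * Real.cosh (t * g j) = ∑ u : ℤˣ, Real.exp (t * (signVal u * g j)) := by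
      intro j
      rw [UnitsInt.univ, Finset.sum_pair (by decide), Real.cosh_eq]
      simp [signVal]
      ring
    simp_rw [this]
    rw [Finset.prod_univ_sum, Fintype.piFinset_univ]
    refine Finset.sum_congr rfl fun x _ => ?_
    rw [signedSum, Finset.mul_sum, Real.exp_sum]
  rw [key]
  calc ∏ j, (2 * Real.cosh (t * g j)) ≤ ∏ _j : Fin d, (2 * Real.exp (t ^ 2 / 2)) := by
        refine Finset.prod_le_prod (fun j _ => by positivity) fun j _ => ?_
        have : (t * g j) ^ 2 ≤ t ^ 2 := by
          rw [mul_pow]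
          exact mul_le_of_le_one_right (sq_nonneg t) (pow_le_one₀ (h0 j) (h1 j))
        gcongr
        exact (Real.cosh_le_exp_half_sq _).trans (by gcongr)
    _ = _ := by
        rw [Finset.prod_const, Finset.card_univ, Fintype.card_fin, mul_pow, ← Real.exp_nat_mul]
        congr 2
        ring

lemma exp_half_le_two : Real.exp (1 / 2) ≤ 2 := by
  have h : Real.exp (1 / 2) * Real.exp (1 / 2) = Real.exp 1 := by
    rw [← Real.exp_add]; norm_num
  have := Real.exp_one_lt_d9
  nlinarith [Real.exp_pos (1 / 2 : ℝ)]

lemma sum_exp_signedSum_div_sqrt_le (hd : d ≠ 0) {g : Fin d → ℝ} (h0 : ∀ j, 0 ≤ g j)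
    (h1 : ∀ j, g j ≤ 1) : ∑ x, Real.exp (signedSum x g / √d) ≤ 2 ^ d * 2 := by
  have hd' : (0 : ℝ) < d := by positivity
  have := sum_exp_signedSum_le h0 h1 (1 / √d)
  rw [div_pow, Real.sq_sqrt hd'.le, one_pow, one_div_mul_cancel hd'.ne'] at this
  calc ∑ x, Real.exp (signedSum x g / √d) = ∑ x, Real.exp (1 / √d * signedSum x g) := by
        simp only [one_div, inv_mul_eq_div]
    _ ≤ 2 ^ d * Real.exp (1 / 2) := this
    _ ≤ _ := by gcongr; exact exp_half_le_two

/-- Chernoff's argument at scale `√d`: `max u 0 ≤ exp u` with `u = signedSum x g / √d - r`. -/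
lemma sum_posPart_signedSum_sub_le (hd : d ≠ 0) {g : Fin d → ℝ} (h0 : ∀ j, 0 ≤ g j)
    (h1 : ∀ j, g j ≤ 1) (r : ℝ) :
    ∑ x, max (signedSum x g - r * √d) 0 ≤ 2 ^ d * (2 * √d * Real.exp (-r)) := by
  have hd' : (0 : ℝ) < √d := by positivity
  have h := sum_exp_signedSum_div_sqrt_le hd h0 h1
  have : ∀ x, max (signedSum x g - r * √d) 0 ≤
      √d * Real.exp (-r) * Real.exp (signedSum x g / √d) := by
    intro x
    rw [mul_assoc, ← Real.exp_add]
    refine max_le ?_ (by positivity)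
    have := Real.add_one_le_exp (-r + signedSum x g / √d)
    have e : signedSum x g - r * √d = √d * (-r + signedSum x g / √d) := by
      field_simp; ring
    rw [e]
    gcongr
    linarith
  calc ∑ x, max (signedSum x g - r * √d) 0
      ≤ ∑ x, √d * Real.exp (-r) * Real.exp (signedSum x g / √d) := Finset.sum_le_sum fun x _ => this x
    _ = √d * Real.exp (-r) * ∑ x, Real.exp (signedSum x g / √d) := by rw [Finset.mul_sum]
    _ ≤ √d * Real.exp (-r) * (2 ^ d * 2) := by gcongr
    _ = _ := by ring

end Hypercube

/-! ### Approximate closeness of measures -/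

section Close

variable {Z : Type*} [MeasurableSpace Z]

/-- The inequality `μ C ≤ e^ε ν C + δ` for events extends to bounded nonnegative functions. -/
lemma integral_le_exp_mul_integral_add {μ ν : Measure Z} [IsProbabilityMeasure μ]
    [IsProbabilityMeasure ν] {ε δ : ℝ} (hδ : 0 ≤ δ)
    (h : ∀ C, MeasurableSet C → μ C ≤ ENNReal.ofReal (Real.exp ε) * ν C + ENNReal.ofReal δ)
    {f : Z → ℝ} (hf : Measurable f) (h0 : ∀ z, 0 ≤ f z) {B : ℝ} (hB : ∀ z, f z ≤ B) :
    ∫ z, f z ∂μ ≤ Real.exp ε * ∫ z, f z ∂ν + δ * B := by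
  obtain ⟨z₀⟩ : Nonempty Z := nonempty_of_isProbabilityMeasure μ
  have hB0 : 0 ≤ B := (h0 z₀).trans (hB z₀)
  have hint : ∀ (κ : Measure Z) [IsProbabilityMeasure κ], Integrable f κ := fun κ _ =>
    Integrable.of_bound hf.aestronglyMeasurable B
      (Filter.Eventually.of_forall fun z => by rw [Real.norm_of_nonneg (h0 z)]; exact hB z)
  have hnn : ∀ κ : Measure Z, 0 ≤ ∫ z, f z ∂κ := fun κ => integral_nonneg h0
  have key : ∫⁻ z, ENNReal.ofReal (f z) ∂μ ≤
      ENNReal.ofReal (Real.exp ε) * ∫⁻ z, ENNReal.ofReal (f z) ∂ν + ENNReal.ofReal (δ * B) := by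
    -- Layer-cake formula: the event inequality is applied to each superlevel set. Levels `t ≥ B`
    -- are empty, so `δ` is charged only over an interval of length `B`.
    rw [lintegral_eq_lintegral_meas_lt μ (Filter.Eventually.of_forall h0) hf.aemeasurable,
      lintegral_eq_lintegral_meas_lt ν (Filter.Eventually.of_forall h0) hf.aemeasurable]
    have hm : Measurable fun t : ℝ => ν {a | t < f a} :=
      Antitone.measurable fun s t hst => measure_mono fun a (ha : t < f a) => hst.trans_lt ha
    calc ∫⁻ t in Set.Ioi (0 : ℝ), μ {a | t < f a}
        ≤ ∫⁻ t in Set.Ioi (0 : ℝ), (ENNReal.ofReal (Real.exp ε) * ν {a | t < f a} +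
            (Set.Iio B).indicator (fun _ => ENNReal.ofReal δ) t) := by
          refine lintegral_mono fun t => ?_
          by_cases ht : t < B
          · simpa [ht] using h _ (measurableSet_lt measurable_const hf)
          · have : {a | t < f a} = ∅ := by
              ext a
              simpa using (hB a).trans (not_lt.1 ht)
            simp [this]
      _ = _ := by
          rw [lintegral_add_left (hm.const_mul _), lintegral_const_mul _ hm,
            lintegral_indicator measurableSet_Iio, Measure.restrict_restrict measurableSet_Iio,
            setLIntegral_const, Set.Iio_inter_Ioi, Real.volume_Ioo, sub_zero,
            ENNReal.ofReal_mul hδ]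
  rw [← ofReal_integral_eq_lintegral_ofReal (hint μ) (Filter.Eventually.of_forall h0),
    ← ofReal_integral_eq_lintegral_ofReal (hint ν) (Filter.Eventually.of_forall h0),
    ← ENNReal.ofReal_mul (Real.exp_pos _).le,
    ← ENNReal.ofReal_add (mul_nonneg (Real.exp_pos _).le (hnn ν)) (mul_nonneg hδ hB0)] at key
  exact (ENNReal.ofReal_le_ofReal_iff (add_nonneg (mul_nonneg (Real.exp_pos _).le (hnn ν))
    (mul_nonneg hδ hB0))).1 key

variable {d : ℕ}

lemma measurable_signedSum {g : Fin d → Z → ℝ} (hg : ∀ j, Measurable (g j)) (x : Fin d → ℤˣ) :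
    Measurable fun z => signedSum x fun j => g j z := by
  unfold signedSum
  fun_prop

/-- If the laws `K x` for `x ∈ {±1}^d` are pairwise `(ε, δ)`-close, then `d` events cannot be
correlated on average with the corresponding coordinates of a uniformly random `x`. -/
lemma sum_integral_signedSum_le (hd : d ≠ 0) {K : (Fin d → ℤˣ) → Measure Z}
    [∀ x, IsProbabilityMeasure (K x)] {ε δ : ℝ} (hε : 0 < ε) (hδ : 0 ≤ δ)
    (h : ∀ x x' C, MeasurableSet C →
      K x C ≤ ENNReal.ofReal (Real.exp ε) * K x' C + ENNReal.ofReal δ)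
    {g : Fin d → Z → ℝ} (hg : ∀ j, Measurable (g j)) (h0 : ∀ j z, 0 ≤ g j z)
    (h1 : ∀ j z, g j z ≤ 1) :
    ∑ x, ∫ z, signedSum x (fun j => g j z) ∂(K x) ≤ 2 ^ d * (8 * ε * √d + 2 * δ * d) := by
  set T : (Fin d → ℤˣ) → Z → ℝ := fun x z => signedSum x fun j => g j z with hT
  have hTm : ∀ x, Measurable (T x) := measurable_signedSum hg
  have hTb : ∀ x z, |T x z| ≤ d := fun x z =>
    abs_signedSum_le (fun j => h0 j z) (fun j => h1 j z) x
  have hi : ∀ {f : Z → ℝ} (κ : Measure Z) [IsProbabilityMeasure κ], Measurable f → ∀ B : ℝ,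
      (∀ z, |f z| ≤ B) → Integrable f κ := fun κ _ hf B hb =>
    Integrable.of_bound hf.aestronglyMeasurable B (Filter.Eventually.of_forall hb)
  have hdd : (0 : ℝ) ≤ √d := Real.sqrt_nonneg _
  have hcard : (Fintype.card (Fin d → ℤˣ) : ℝ) = 2 ^ d := by simp
  have hpos0 : ∀ x z, 0 ≤ max (T x z) 0 := fun x z => le_max_right _ _
  have hneg0 : ∀ x z, 0 ≤ max (-T x z) 0 := fun x z => le_max_right _ _
  have hposb : ∀ x z, max (T x z) 0 ≤ d := fun x z =>
    max_le ((le_abs_self _).trans (hTb x z)) (Nat.cast_nonneg d)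
  have hnegb : ∀ x z, max (-T x z) 0 ≤ d := fun x z =>
    max_le ((neg_le_abs _).trans (hTb x z)) (Nat.cast_nonneg d)
  have hposm : ∀ x, Measurable fun z => max (T x z) 0 := fun x => (hTm x).max measurable_const
  have hnegm : ∀ x, Measurable fun z => max (-T x z) 0 := fun x => (hTm x).neg.max measurable_const
  -- For small `ε` the gain must be linear in `ε`, so both the positive and the negative part of `T`
  -- are transferred to the reference law `K 1`. For `ε ≥ 1` a truncation suffices.
  rcases le_total ε 1 with hε1 | hε1
  · have hpi : ∀ x x', Integrable (fun z => max (T x z) 0) (K x') := fun x x' =>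
      hi _ (hposm x) d fun z => by rw [abs_of_nonneg (hpos0 x z)]; exact hposb x z
    have hni : ∀ x x', Integrable (fun z => max (-T x z) 0) (K x') := fun x x' =>
      hi _ (hnegm x) d fun z => by rw [abs_of_nonneg (hneg0 x z)]; exact hnegb x z
    have hsi : ∀ x, Integrable (fun z => Real.exp ε * max (T x z) 0 -
        Real.exp (-ε) * max (-T x z) 0) (K 1) := fun x =>
      ((hpi x 1).const_mul _).sub ((hni x 1).const_mul _)
    have hx : ∀ x, ∫ z, T x z ∂(K x) ≤ ∫ z, (Real.exp ε * max (T x z) 0 -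
        Real.exp (-ε) * max (-T x z) 0) ∂(K 1) + 2 * δ * d := by
      intro x
      have e : ∫ z, T x z ∂(K x) = ∫ z, max (T x z) 0 ∂(K x) - ∫ z, max (-T x z) 0 ∂(K x) := by
        rw [← integral_sub (hpi x x) (hni x x)]
        refine integral_congr_ae (Filter.Eventually.of_forall fun z => ?_)
        change T x z = max (T x z) 0 - max (-T x z) 0
        rcases le_total (T x z) 0 with hz | hz
        · rw [max_eq_right hz, max_eq_left (by linarith)]; ring
        · rw [max_eq_left hz, max_eq_right (by linarith)]; ring
      have a := integral_le_exp_mul_integral_add hδ (h x 1) (hposm x) (hpos0 x) (hposb x)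
      -- Privacy is used in the reverse direction here, since the negative part needs a lower bound
      -- under `K x`.
      have b := integral_le_exp_mul_integral_add hδ (h 1 x) (hnegm x) (hneg0 x) (hnegb x)
      rw [e, integral_sub ((hpi x 1).const_mul _) ((hni x 1).const_mul _), integral_const_mul,
        integral_const_mul]
      have hexp : Real.exp (-ε) * Real.exp ε = 1 := by rw [← Real.exp_add]; simp
      have hle : Real.exp (-ε) ≤ 1 := Real.exp_le_one_iff.2 (by linarith)
      have b' := mul_le_mul_of_nonneg_left b (Real.exp_pos (-ε)).le
      rw [mul_add, ← mul_assoc, hexp, one_mul] at b'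
      have hδd : 0 ≤ δ * d := by positivity
      nlinarith
    have hpt : ∀ z, ∑ x, (Real.exp ε * max (T x z) 0 - Real.exp (-ε) * max (-T x z) 0) ≤
        2 ^ d * (8 * ε * √d) := by
      intro z
      -- Once the law no longer depends on `x`, the sum over the cube can be taken at fixed `z`.
      -- Mean zero makes the positive and negative parts equal in total, leaving the factor `exp ε -
      -- exp (-ε)`.
      have s0 : ∑ x, T x z = 0 := sum_signedSum _
      have s1 : ∑ x, max (-T x z) 0 = ∑ x, max (T x z) 0 := by
        have : ∀ x, max (T x z) 0 = max (-T x z) 0 + T x z := by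
          intro x
          rcases le_total (T x z) 0 with hz | hz
          · rw [max_eq_right hz, max_eq_left (by linarith)]; ring
          · rw [max_eq_left hz, max_eq_right (by linarith)]; ring
        simp_rw [this, Finset.sum_add_distrib, s0, add_zero]
      have s2 := sum_posPart_signedSum_sub_le hd (fun j => h0 j z) (fun j => h1 j z) 0
      simp only [zero_mul, sub_zero, neg_zero, Real.exp_zero, mul_one] at s2
      rw [Finset.sum_sub_distrib, ← Finset.mul_sum, ← Finset.mul_sum, s1, ← sub_mul]
      have u1 : Real.exp ε - Real.exp (-ε) ≤ 4 * ε := by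
        have := Real.abs_exp_sub_one_le (x := ε) (by rw [abs_of_pos hε]; exact hε1)
        rw [abs_of_pos hε] at this
        have := (abs_le.1 this).2
        have := Real.add_one_le_exp (-ε)
        linarith
      have u2 : 0 ≤ ∑ x, max (T x z) 0 := Finset.sum_nonneg fun x _ => hpos0 x z
      calc (Real.exp ε - Real.exp (-ε)) * ∑ x, max (T x z) 0
          ≤ (4 * ε) * ∑ x, max (T x z) 0 := by gcongr
        _ ≤ (4 * ε) * (2 ^ d * (2 * √d)) := by gcongr
        _ = _ := by ring
    calc ∑ x, ∫ z, T x z ∂(K x)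
        ≤ ∑ x, (∫ z, (Real.exp ε * max (T x z) 0 - Real.exp (-ε) * max (-T x z) 0) ∂(K 1) +
            2 * δ * d) := Finset.sum_le_sum fun x _ => hx x
      _ = ∫ z, ∑ x, (Real.exp ε * max (T x z) 0 - Real.exp (-ε) * max (-T x z) 0) ∂(K 1) +
            2 ^ d * (2 * δ * d) := by
          rw [Finset.sum_add_distrib, integral_finsetSum _ fun x _ => hsi x, Finset.sum_const,
            Finset.card_univ, nsmul_eq_mul, hcard]
      _ ≤ ∫ _z, 2 ^ d * (8 * ε * √d) ∂(K 1) + 2 ^ d * (2 * δ * d) := by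
          gcongr ?_ + _
          exact integral_mono (integrable_finsetSum _ fun x _ => hsi x) (integrable_const _) hpt
      _ = _ := by simp; ring
  -- Only the excess above `ε√d` is transferred to `K 1`: its Chernoff factor `exp (-ε)` cancels the
  -- privacy loss `exp ε`.
  · set M : (Fin d → ℤˣ) → Z → ℝ := fun x z => max (T x z - ε * √d) 0 with hM
    have hM0 : ∀ x z, 0 ≤ M x z := fun x z => le_max_right _ _
    have hMb : ∀ x z, M x z ≤ d := fun x z =>
      max_le (by
        have := (le_abs_self _).trans (hTb x z)
        have : 0 ≤ ε * √d := by positivity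
        linarith) (Nat.cast_nonneg d)
    have hMm : ∀ x, Measurable (M x) := fun x => ((hTm x).sub measurable_const).max measurable_const
    have hMi : ∀ x x', Integrable (M x) (K x') := fun x x' =>
      hi _ (hMm x) d fun z => by rw [abs_of_nonneg (hM0 x z)]; exact hMb x z
    have hx : ∀ x, ∫ z, T x z ∂(K x) ≤ ε * √d + (Real.exp ε * ∫ z, M x z ∂(K 1) + δ * d) := by
      intro x
      have a := integral_le_exp_mul_integral_add hδ (h x 1) (hMm x) (hM0 x) (hMb x)
      calc ∫ z, T x z ∂(K x) ≤ ∫ z, (ε * √d + M x z) ∂(K x) := by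
            refine integral_mono (hi _ (hTm x) d (hTb x)) ((integrable_const _).add (hMi x x))
              fun z => ?_
            have : T x z - ε * √d ≤ M x z := le_max_left _ _
            change T x z ≤ ε * √d + M x z
            linarith
        _ = ε * √d + ∫ z, M x z ∂(K x) := by
            rw [integral_add (integrable_const _) (hMi x x)]; simp
        _ ≤ _ := by gcongr
    have hpt : ∀ z, ∑ x, M x z ≤ 2 ^ d * (2 * √d * Real.exp (-ε)) := fun z =>
      sum_posPart_signedSum_sub_le hd (fun j => h0 j z) (fun j => h1 j z) ε
    have hMsum : ∑ x, ∫ z, M x z ∂(K 1) ≤ 2 ^ d * (2 * √d * Real.exp (-ε)) := by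
      rw [← integral_finsetSum _ fun x _ => hMi x 1]
      calc ∫ z, ∑ x, M x z ∂(K 1) ≤ ∫ _z, 2 ^ d * (2 * √d * Real.exp (-ε)) ∂(K 1) :=
            integral_mono (integrable_finsetSum _ fun x _ => hMi x 1) (integrable_const _) hpt
        _ = _ := by simp
    calc ∑ x, ∫ z, T x z ∂(K x)
        ≤ ∑ x, (ε * √d + (Real.exp ε * ∫ z, M x z ∂(K 1) + δ * d)) :=
          Finset.sum_le_sum fun x _ => hx x
      _ = 2 ^ d * (ε * √d + δ * d) + Real.exp ε * ∑ x, ∫ z, M x z ∂(K 1) := by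
          simp only [Finset.sum_add_distrib, Finset.sum_const, Finset.card_univ, nsmul_eq_mul,
            hcard, ← Finset.mul_sum]
          ring
      _ ≤ 2 ^ d * (ε * √d + δ * d) + Real.exp ε * (2 ^ d * (2 * √d * Real.exp (-ε))) := by gcongr
      _ = 2 ^ d * (ε * √d + δ * d + 2 * √d) := by
          have hexp : Real.exp (-ε) * Real.exp ε = 1 := by rw [← Real.exp_add]; simp
          linear_combination (2 ^ d * (2 * √d)) * hexp
      _ ≤ _ := by
          have : √d ≤ ε * √d := le_mul_of_one_le_left hdd hε1
          have : 0 ≤ δ * d := by positivity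
          refine mul_le_mul_of_nonneg_left ?_ (by positivity)
          nlinarith

end Close

/-! ### Biased product distributions on the hypercube -/

section BiasedWeight

variable {d : ℕ}

/-- The weights of the uniform distribution on `{±1}^d`. -/
def uniformWeight (d : ℕ) (_ : Fin d → ℤˣ) : ℝ≥0∞ := ENNReal.ofReal ((2 ^ d)⁻¹)

/-- The weights of the product distribution on `{±1}^d` whose `j`-th coordinate has mean `b` and
whose other coordinates are uniform. -/
def biasedWeight (b : ℝ) (j : Fin d) (x : Fin d → ℤˣ) : ℝ≥0∞ :=
  ENNReal.ofReal ((2 ^ d)⁻¹ * (1 + b * signVal (x j)))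

lemma one_add_mul_signVal_nonneg {b : ℝ} (hb0 : 0 ≤ b) (hb1 : b ≤ 1) (u : ℤˣ) :
    0 ≤ 1 + b * signVal u := by
  rcases Int.units_eq_one_or u with rfl | rfl <;> simp [signVal] <;> linarith

lemma sum_hypercube_const (c : ℝ) : ∑ _x : Fin d → ℤˣ, c = 2 ^ d * c := by simp

lemma sum_uniformWeight : ∑ x, uniformWeight d x = 1 := by
  simp only [uniformWeight]
  rw [← ENNReal.ofReal_sum_of_nonneg fun _ _ => by positivity, sum_hypercube_const,
    mul_inv_cancel₀ (by positivity), ENNReal.ofReal_one]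

lemma sum_biasedWeight {b : ℝ} (hb0 : 0 ≤ b) (hb1 : b ≤ 1) (j : Fin d) :
    ∑ x, biasedWeight b j x = 1 := by
  simp only [biasedWeight]
  rw [← ENNReal.ofReal_sum_of_nonneg fun x _ =>
    mul_nonneg (by positivity) (one_add_mul_signVal_nonneg hb0 hb1 _), ← Finset.mul_sum,
    Finset.sum_add_distrib, ← Finset.mul_sum, sum_signVal, sum_hypercube_const, mul_zero, add_zero,
    mul_one, inv_mul_cancel₀ (by positivity), ENNReal.ofReal_one]

/-- The weights are affine in the bias, and uniform means bias 0. This decomposition produces the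
binomial number of uniform rows. -/
lemma average_uniformWeight_biasedWeight {b : ℝ} (hb0 : 0 ≤ b) (hb1 : b ≤ 1) (j : Fin d) :
    (fun x => 2⁻¹ * (uniformWeight d x + biasedWeight b j x)) = biasedWeight (b / 2) j := by
  funext x
  have h2 : (2⁻¹ : ℝ≥0∞) = ENNReal.ofReal 2⁻¹ := by
    rw [ENNReal.ofReal_inv_of_pos two_pos, ENNReal.ofReal_ofNat]
  rw [uniformWeight, biasedWeight, biasedWeight, h2, ← ENNReal.ofReal_add (by positivity)
    (mul_nonneg (by positivity) (one_add_mul_signVal_nonneg hb0 hb1 _)),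
    ← ENNReal.ofReal_mul (by positivity)]
  congr 1
  ring

/-- The product distribution on `{±1}^d` whose `j`-th coordinate has mean `b` and whose other
coordinates are uniform. -/
def biasedMeasure (b : ℝ) (j : Fin d) : Measure (Fin d → ℤˣ) :=
  ∑ x, biasedWeight b j x • Measure.dirac x

lemma biasedMeasure_singleton (b : ℝ) (j : Fin d) (x : Fin d → ℤˣ) :
    biasedMeasure b j {x} = biasedWeight b j x := by
  simp [biasedMeasure, Set.indicator_apply]

lemma isProbabilityMeasure_biasedMeasure {b : ℝ} (hb0 : 0 ≤ b) (hb1 : b ≤ 1) (j : Fin d) :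
    IsProbabilityMeasure (biasedMeasure b j) := by
  constructor
  simp [biasedMeasure, sum_biasedWeight hb0 hb1 j]

lemma integral_signVal_biasedMeasure {b : ℝ} (hb0 : 0 ≤ b) (hb1 : b ≤ 1) (i j : Fin d) :
    ∫ x, signVal (x i) ∂(biasedMeasure b j) = if i = j then b else 0 := by
  have := isProbabilityMeasure_biasedMeasure hb0 hb1 j
  rw [integral_fintype Integrable.of_finite]
  have : ∀ x : Fin d → ℤˣ, (biasedMeasure b j).real {x} • signVal (x i) =
      (2 ^ d)⁻¹ * (signVal (x i) + b * (signVal (x i) * signVal (x j))) := by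
    intro x
    rw [Measure.real, biasedMeasure_singleton, biasedWeight, ENNReal.toReal_ofReal
      (mul_nonneg (by positivity) (one_add_mul_signVal_nonneg hb0 hb1 _)), smul_eq_mul]
    ring
  simp_rw [this]
  rw [← Finset.mul_sum, Finset.sum_add_distrib, ← Finset.mul_sum, sum_signVal,
    sum_signVal_mul_signVal, zero_add]
  split_ifs
  · field_simp
  · simp

end BiasedWeight

/-! ### Selection from biased coordinates -/

section Step

variable {d : ℕ}

/-- The biased and uniform weights differ by `2⁻ᵈ b xⱼ`, so the gap between the two sums is `b`
times the average signed sum bounded in `sum_integral_signedSum_le`. -/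
lemma sum_biasedWeight_mul_lintegral_le {Z : Type*} [MeasurableSpace Z] (hd : d ≠ 0)
    {K : (Fin d → ℤˣ) → Measure Z} [∀ x, IsProbabilityMeasure (K x)] {ε δ b : ℝ} (hε : 0 < ε)
    (hδ : 0 ≤ δ) (hb0 : 0 ≤ b) (hb1 : b ≤ 1)
    (h : ∀ x x' C, MeasurableSet C →
      K x C ≤ ENNReal.ofReal (Real.exp ε) * K x' C + ENNReal.ofReal δ)
    {G : Fin d → Z → ℝ≥0∞} (hG : ∀ j, Measurable (G j)) (hG1 : ∀ j z, G j z ≤ 1) :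
    ∑ j, ∑ x, biasedWeight b j x * ∫⁻ z, G j z ∂(K x) ≤
      ∑ j, ∑ x, uniformWeight d x * ∫⁻ z, G j z ∂(K x) +
        ENNReal.ofReal (b * (8 * ε * √d + 2 * δ * d)) := by
  set g : Fin d → Z → ℝ := fun j z => (G j z).toReal with hg
  have hgm : ∀ j, Measurable (g j) := fun j => (hG j).ennreal_toReal
  have hg0 : ∀ j z, 0 ≤ g j z := fun j z => ENNReal.toReal_nonneg
  have hg1 : ∀ j z, g j z ≤ 1 := fun j z =>
    ENNReal.toReal_le_of_le_ofReal zero_le_one (by simpa using hG1 j z)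
  have hgi : ∀ j x, Integrable (g j) (K x) := fun j x =>
    Integrable.of_bound (hgm j).aestronglyMeasurable 1 (Filter.Eventually.of_forall fun z => by
      rw [Real.norm_of_nonneg (hg0 j z)]; exact hg1 j z)
  set I : Fin d → (Fin d → ℤˣ) → ℝ := fun j x => ∫ z, g j z ∂(K x) with hI
  have hI0 : ∀ j x, 0 ≤ I j x := fun j x => integral_nonneg (hg0 j)
  have hGI : ∀ j x, ∫⁻ z, G j z ∂(K x) = ENNReal.ofReal (I j x) := by
    intro j x
    rw [hI, ofReal_integral_eq_lintegral_ofReal (hgi j x) (Filter.Eventually.of_forall (hg0 j))]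
    refine lintegral_congr fun z => ?_
    rw [hg, ENNReal.ofReal_toReal ((hG1 j z).trans_lt ENNReal.one_lt_top).ne]
  have hw : ∀ (j : Fin d) (x : Fin d → ℤˣ), 0 ≤ ((2 : ℝ) ^ d)⁻¹ * (1 + b * signVal (x j)) :=
    fun j x => mul_nonneg (by positivity) (one_add_mul_signVal_nonneg hb0 hb1 _)
  have hu : (0 : ℝ) ≤ (2 ^ d)⁻¹ := by positivity
  simp_rw [hGI, biasedWeight, uniformWeight, ← ENNReal.ofReal_mul (hw _ _),
    ← ENNReal.ofReal_mul hu]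
  have e₁ : ∀ j, ∑ x, ENNReal.ofReal ((2 ^ d)⁻¹ * (1 + b * signVal (x j)) * I j x) =
      ENNReal.ofReal (∑ x, (2 ^ d)⁻¹ * (1 + b * signVal (x j)) * I j x) := fun j =>
    (ENNReal.ofReal_sum_of_nonneg fun x _ => mul_nonneg (hw j x) (hI0 j x)).symm
  have e₂ : ∀ j, ∑ x, ENNReal.ofReal ((2 ^ d)⁻¹ * I j x) =
      ENNReal.ofReal (∑ x, (2 ^ d)⁻¹ * I j x) := fun j =>
    (ENNReal.ofReal_sum_of_nonneg fun x _ => mul_nonneg hu (hI0 j x)).symm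
  simp_rw [e₁, e₂]
  have n₁ : ∀ j, 0 ≤ ∑ x, (2 ^ d)⁻¹ * (1 + b * signVal (x j)) * I j x := fun j =>
    Finset.sum_nonneg fun x _ => mul_nonneg (hw j x) (hI0 j x)
  have n₂ : ∀ j, 0 ≤ ∑ x, (2 ^ d)⁻¹ * I j x := fun j =>
    Finset.sum_nonneg fun x _ => mul_nonneg hu (hI0 j x)
  rw [← ENNReal.ofReal_sum_of_nonneg fun j _ => n₁ j,
    ← ENNReal.ofReal_sum_of_nonneg fun j _ => n₂ j,
    ← ENNReal.ofReal_add (Finset.sum_nonneg fun j _ => n₂ j) (by positivity)]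
  refine ENNReal.ofReal_le_ofReal ?_
  have key := sum_integral_signedSum_le hd hε hδ h hgm hg0 hg1
  have e₃ : ∀ x, ∫ z, signedSum x (fun j => g j z) ∂(K x) = ∑ j, signVal (x j) * I j x := by
    intro x
    simp only [signedSum]
    rw [integral_finsetSum _ fun j _ => (hgi j x).const_mul _]
    simp only [integral_const_mul, hI]
  simp_rw [e₃] at key
  rw [Finset.sum_comm] at key
  have e₄ : ∑ j, ∑ x, (2 ^ d)⁻¹ * (1 + b * signVal (x j)) * I j x =
      ∑ j, ∑ x, (2 ^ d)⁻¹ * I j x + (2 ^ d)⁻¹ * b * ∑ j, ∑ x, signVal (x j) * I j x := by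
    simp only [Finset.mul_sum, ← Finset.sum_add_distrib]
    refine Finset.sum_congr rfl fun j _ => Finset.sum_congr rfl fun x _ => ?_
    ring
  rw [e₄]
  refine add_le_add_right ?_ _
  calc (2 ^ d)⁻¹ * b * ∑ j, ∑ x, signVal (x j) * I j x
      ≤ (2 ^ d)⁻¹ * b * (2 ^ d * (8 * ε * √d + 2 * δ * d)) := by gcongr
    _ = b * (8 * ε * √d + 2 * δ * d) := by field_simp

variable {W Y : Type*} [MeasurableSpace W] [MeasurableSpace Y]

lemma Neighbors.cons {X : Type*} {m : ℕ} (a : Fin m → X) (x x' : X) :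
    Neighbors (Fin.cons x a : Fin (m + 1) → X) (Fin.cons x' a) := by
  have : ∀ i : Fin (m + 1),
      (Fin.cons x a : Fin (m + 1) → X) i ≠ (Fin.cons x' a : Fin (m + 1) → X) i → i = 0 := by
    intro i
    refine Fin.cases (fun _ => rfl) (fun i hi => ?_) i
    simp at hi
  intro i hi j hj
  rw [this i hi, this j hj]

/-- Probability that the protocol outputs `j` when the `n` rows are `k` uniform ones and `n - k`
ones whose `j`-th coordinate is biased. -/
def hybridProb (Pr : ShuffleProtocol (Fin d → ℤˣ) W Y (Fin d)) (n : ℕ) (b : ℝ) (j : Fin d)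
    (k : ℕ) : ℝ≥0∞ :=
  (sampleStep (uniformWeight d) ^ k) ((sampleStep (biasedWeight b j) ^ (n - k))
    (Pr.outputProb n (MeasurableSet.singleton j))) 0

lemma hybridProb_le_one (Pr : ShuffleProtocol (Fin d → ℤˣ) W Y (Fin d)) (n : ℕ) {b : ℝ}
    (hb0 : 0 ≤ b) (hb1 : b ≤ 1) (j : Fin d) (k : ℕ) : hybridProb Pr n b j k ≤ 1 :=
  sampleStep_pow_le_const sum_uniformWeight k
    (sampleStep_pow_le_const (sum_biasedWeight hb0 hb1 j) _ (Pr.outputProb_le_one n _)) 0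

/-- With no biased row left, the law of the data is the same for every `j`, so these are
probabilities of disjoint events in a single experiment. -/
lemma sum_hybridProb_self_le (Pr : ShuffleProtocol (Fin d → ℤˣ) W Y (Fin d)) (n : ℕ) (b : ℝ) :
    ∑ j, hybridProb Pr n b j n ≤ 1 := by
  have hs : ∑ j, hybridProb Pr n b j n = (sampleStep (uniformWeight d) ^ n)
      (∑ j, Pr.outputProb n (MeasurableSet.singleton j)) 0 := by
    simp [hybridProb, Finset.sum_apply]
  have hone : ∀ s : Multiset (Fin d → ℤˣ), s.card = 0 + n →
      (∑ j, Pr.outputProb n (MeasurableSet.singleton j)) s ≤ (fun _ => 1) s + 0 := by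
    intro s
    obtain ⟨l, rfl⟩ : ∃ l : List (Fin d → ℤˣ), s = ↑l := ⟨s.toList, s.coe_toList.symm⟩
    intro hl
    have hl' : l.length = n := by simpa using hl
    subst hl'
    have h := fun j : Fin d => Pr.output_apply_eq l.length (MeasurableSet.singleton j) l.get
    rw [List.ofFn_get] at h
    rw [Finset.sum_apply, add_zero]
    calc ∑ j, Pr.outputProb l.length (MeasurableSet.singleton j) ↑l
        = ∑ j, Pr.output l.length l.get {j} := Finset.sum_congr rfl fun j _ => (h j).symm
      _ = 1 := by rw [sum_measure_singleton]; simp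
      _ ≤ 1 := le_rfl
  have := sampleStep_pow_le sum_uniformWeight 0 n 0 hone 0 rfl
  rw [sampleStep_pow_const sum_uniformWeight, add_zero] at this
  rw [hs]
  exact this

/-- One hybrid step. The private crowd consists of the `k` uniform users and the user whose row
changes, which is why `k + 1` must be at least `n / 3`. -/
lemma sum_hybridProb_le_succ (hd : d ≠ 0) (Pr : ShuffleProtocol (Fin d → ℤˣ) W Y (Fin d))
    {ε δ b : ℝ} (hε : 0 < ε) (hδ : 0 ≤ δ) (hb0 : 0 ≤ b) (hb1 : b ≤ 1)
    (hPr : Pr.IsRobustlyPrivate ε δ (1 / 3)) {n k : ℕ} (hk : k + 1 ≤ n) (hnk : n ≤ 3 * (k + 1)) :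
    ∑ j, hybridProb Pr n b j k ≤ ∑ j, hybridProb Pr n b j (k + 1) +
      ENNReal.ofReal (b * (8 * ε * √d + 2 * δ * d)) := by
  set D := ENNReal.ofReal (b * (8 * ε * √d + 2 * δ * d))
  set Ψ : Fin d → Multiset (Fin d → ℤˣ) → ℝ≥0∞ := fun j =>
    (sampleStep (biasedWeight b j) ^ (n - (k + 1)))
      (Pr.outputProb n (MeasurableSet.singleton j)) with hΨ
  have e₁ : ∑ j, hybridProb Pr n b j k = (sampleStep (uniformWeight d) ^ k)
      (∑ j, sampleStep (biasedWeight b j) (Ψ j)) 0 := by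
    rw [map_sum, Finset.sum_apply]
    refine Finset.sum_congr rfl fun j _ => ?_
    rw [hybridProb, hΨ, ← Module.End.mul_apply (sampleStep (biasedWeight b j)), ← pow_succ',
      show n - (k + 1) + 1 = n - k by omega]
  have e₂ : ∑ j, hybridProb Pr n b j (k + 1) = (sampleStep (uniformWeight d) ^ k)
      (∑ j, sampleStep (uniformWeight d) (Ψ j)) 0 := by
    rw [map_sum, Finset.sum_apply]
    refine Finset.sum_congr rfl fun j _ => ?_
    rw [hybridProb, ← Module.End.mul_apply (sampleStep (uniformWeight d) ^ k), ← pow_succ]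
  rw [e₁, e₂]
  refine sampleStep_pow_le sum_uniformWeight D k 0 (fun s hs => ?_) 0 rfl
  obtain ⟨a, rfl⟩ : ∃ a : Fin k → Fin d → ℤˣ, s = ↑(List.ofFn a) := by
    obtain ⟨l, rfl⟩ : ∃ l : List (Fin d → ℤˣ), s = ↑l := ⟨s.toList, s.coe_toList.symm⟩
    have hl : l.length = k := by simpa using hs
    subst hl
    exact ⟨l.get, by simp⟩
  -- For each `j`, the other biased users are folded into a statistic `g j` of one and the same
  -- view. The `g j` need not sum to at most 1, so only the bounds `0 ≤ g j ≤ 1` are used below.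
  choose g hg hg1 hinv hgΨ using fun j => Pr.exists_statistic_sampleStep_pow n
    (MeasurableSet.singleton j) (sum_biasedWeight hb0 hb1 j) (n - (k + 1))
  have hview : ∀ j x, Ψ j (x ::ₘ ↑(List.ofFn a)) =
      ∫⁻ z, g j z ∂(Pr.view n (k + 1) (Fin.cons x a : Fin (k + 1) → Fin d → ℤˣ)) := by
    intro j x
    rw [Pr.lintegral_view_of_perm_invariant n (k + 1) _ (hg j) (hinv j), Multiset.cons_coe,
      List.ofFn_cons]
    exact hgΨ j _
  simp only [Finset.sum_apply, sampleStep_apply, hview]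
  refine sum_biasedWeight_mul_lintegral_le hd hε hδ hb0 hb1 (fun x x' C hC => ?_) hg hg1
  refine hPr n (k + 1) ?_ hk _ _ (Neighbors.cons a x x') C hC
  have : (n : ℝ) ≤ 3 * (k + 1) := by exact_mod_cast hnk
  push_cast
  linarith

lemma sum_hybridProb_le (hd : d ≠ 0) (Pr : ShuffleProtocol (Fin d → ℤˣ) W Y (Fin d))
    {ε δ b : ℝ} (hε : 0 < ε) (hδ : 0 ≤ δ) (hb0 : 0 ≤ b) (hb1 : b ≤ 1)
    (hPr : Pr.IsRobustlyPrivate ε δ (1 / 3)) {n k : ℕ} (hk : k ≤ n) (hnk : n ≤ 3 * (k + 1)) :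
    ∑ j, hybridProb Pr n b j k ≤
      1 + n * ENNReal.ofReal (b * (8 * ε * √d + 2 * δ * d)) := by
  set D := ENNReal.ofReal (b * (8 * ε * √d + 2 * δ * d))
  -- Induction on the number `i` of biased rows; the condition `n ≤ 3 * (k + 1)` persists as `k`
  -- increases to `n`.
  suffices h : ∀ i, ∀ k, k + i = n → n ≤ 3 * (k + 1) →
      ∑ j, hybridProb Pr n b j k ≤ 1 + i * D by
    refine (h (n - k) k (by omega) hnk).trans ?_
    gcongr
    omega
  intro i
  induction i with
  | zero =>
    intro k hk _
    obtain rfl : k = n := by omega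
    simpa using sum_hybridProb_self_le Pr k b
  | succ i ih =>
    intro k hk hnk
    calc _ ≤ _ := sum_hybridProb_le_succ hd Pr hε hδ hb0 hb1 hPr (by omega) hnk
      _ ≤ 1 + i * D + D := by gcongr; exact ih (k + 1) (by omega) (by omega)
      _ = _ := by push_cast; ring

lemma le_sum_choose_mul_hybridProb (Pr : ShuffleProtocol (Fin d → ℤˣ) W Y (Fin d)) {n : ℕ}
    {α b : ℝ} (hα : 0 < α) (hb : α < b / 2) (hb1 : b ≤ 1) (hsel : SolvesSelection (Pr.output n) α)
    (j : Fin d) :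
    ENNReal.ofReal (99 / 100) ≤
      ∑ k ∈ Finset.range (n + 1), 2⁻¹ ^ n * n.choose k * hybridProb Pr n b j k := by
  have hb0 : 0 ≤ b / 2 := by linarith
  have hb1' : b / 2 ≤ 1 := by linarith
  have hP := isProbabilityMeasure_biasedMeasure hb0 hb1' j
  -- Coordinate `j` has mean `b / 2 > α` and every other one mean 0, so `j` is the only acceptable
  -- answer.
  have hsub : {J : Fin d | ∀ i, ∫ x, ((x i : ℤ) : ℝ) ∂(biasedMeasure (b / 2) j) - α ≤
      ∫ x, ((x J : ℤ) : ℝ) ∂(biasedMeasure (b / 2) j)} ⊆ {j} := by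
    intro J hJ
    have h := hJ j
    have e := fun i => integral_signVal_biasedMeasure hb0 hb1' i j
    simp only [signVal] at e
    rw [e, e, if_pos rfl] at h
    by_contra hne
    rw [if_neg (by simpa using hne)] at h
    linarith
  refine (hsel _ hP).trans ((measure_mono hsub).trans (le_of_eq ?_))
  rw [Measure.bind_apply (MeasurableSet.singleton j) (Kernel.aemeasurable _)]
  simp_rw [Pr.output_apply_eq n (MeasurableSet.singleton j), ← Pr.outputProb_coe n
    (MeasurableSet.singleton j)]
  rw [lintegral_pi_eq_sampleStep_pow]
  simp_rw [biasedMeasure_singleton]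
  have := average_uniformWeight_biasedWeight (by linarith : 0 ≤ b) hb1 j
  change (sampleStep (biasedWeight (b / 2) j) ^ n) _ 0 = _
  rw [← this, sampleStep_average_pow]
  rfl

end Step

/-! ### A binomial tail -/

lemma sum_choose_div_two_pow (n : ℕ) :
    ∑ k ∈ Finset.range (n + 1), (2⁻¹ ^ n * n.choose k : ℝ) = 1 := by
  rw [← Finset.mul_sum]
  have : ∑ k ∈ Finset.range (n + 1), (n.choose k : ℝ) = 2 ^ n := by
    exact_mod_cast Nat.sum_range_choose n
  rw [this, ← mul_pow]
  norm_num

/-- An upper bound for the indicator function of `3 * (k + 1) < n` with small binomial mean. -/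
def tailWeight (n k : ℕ) : ℝ := (8 / 5) ^ n * 4⁻¹ ^ (k + 1)

/-- The base `8 / 5` is chosen so that `(8 / 5)³ / 4 = 1.024 ≥ 1`, while its binomial mean stays
bounded in `sum_choose_mul_tailWeight`. -/
lemma one_le_tailWeight {n k : ℕ} (h : 3 * (k + 1) ≤ n) : 1 ≤ tailWeight n k := by
  have h1 : ((8 / 5 : ℝ)) ^ (3 * (k + 1)) ≤ (8 / 5) ^ n := pow_le_pow_right₀ (by norm_num) h
  calc (1 : ℝ) ≤ ((8 / 5) ^ 3 * 4⁻¹) ^ (k + 1) := one_le_pow₀ (by norm_num)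
    _ = (8 / 5) ^ (3 * (k + 1)) * 4⁻¹ ^ (k + 1) := by rw [mul_pow, pow_mul]
    _ ≤ _ := by unfold tailWeight; gcongr

/-- The binomial generating function at `1 / 4` is `(5 / 8)ⁿ`, which cancels `(8 / 5)ⁿ` exactly; the
spare factor `4⁻¹` remains. -/
lemma sum_choose_mul_tailWeight (n : ℕ) :
    ∑ k ∈ Finset.range (n + 1), (2⁻¹ ^ n * n.choose k * tailWeight n k : ℝ) = 1 / 4 := by
  have h := add_pow (4⁻¹ : ℝ) 1 n
  have : ∀ k, (2⁻¹ ^ n * n.choose k * tailWeight n k : ℝ) =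
      4⁻¹ * (4 / 5) ^ n * (4⁻¹ ^ k * 1 ^ (n - k) * n.choose k) := by
    intro k
    rw [tailWeight, one_pow, pow_succ, show (4 / 5 : ℝ) = 2⁻¹ * (8 / 5) by norm_num, mul_pow]
    ring
  simp_rw [this]
  rw [← Finset.mul_sum, ← h, mul_assoc, ← mul_pow]
  norm_num

/-! ### The lower bound -/

lemma selection_dimension_le {d : ℕ} (hd : d ≠ 0) {W Y : Type*} [MeasurableSpace W]
    [MeasurableSpace Y] (Pr : ShuffleProtocol (Fin d → ℤˣ) W Y (Fin d)) {α ε δ b : ℝ}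
    (hα : 0 < α) (hε : 0 < ε) (hδ : 0 ≤ δ) (hb : α < b / 2) (hb1 : b ≤ 1)
    (hPr : Pr.IsRobustlyPrivate ε δ (1 / 3)) {n : ℕ} (hsel : SolvesSelection (Pr.output n) α) :
    d * (99 / 100) ≤ 1 + n * (b * (8 * ε * √d + 2 * δ * d)) + d * (1 / 4) := by
  have hb0 : 0 ≤ b := by linarith
  set D := b * (8 * ε * √d + 2 * δ * d) with hD
  have hD0 : 0 ≤ D := by positivity
  have htail : ∀ k, 0 ≤ tailWeight n k := fun k => by unfold tailWeight; positivity
  have hS : ∀ k ∈ Finset.range (n + 1), ∑ j, hybridProb Pr n b j k ≤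
      ENNReal.ofReal (1 + n * D + d * tailWeight n k) := by
    intro k hk
    have hkn : k ≤ n := by simpa [Nat.lt_succ_iff] using hk
    -- Either robustness covers every step from `k` up to `n`, or the trivial bound `d` is paid for
    -- by the tail weight.
    rcases le_total n (3 * (k + 1)) with h | h
    · calc _ ≤ 1 + (n : ℝ≥0∞) * ENNReal.ofReal D :=
            sum_hybridProb_le hd Pr hε hδ hb0 hb1 hPr hkn h
        _ = ENNReal.ofReal (1 + n * D) := by
            rw [ENNReal.ofReal_add zero_le_one (by positivity), ENNReal.ofReal_one,
              ENNReal.ofReal_mul (Nat.cast_nonneg n), ENNReal.ofReal_natCast]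
        _ ≤ _ := ENNReal.ofReal_le_ofReal
            (le_add_of_nonneg_right (mul_nonneg (Nat.cast_nonneg d) (htail k)))
    · calc ∑ j, hybridProb Pr n b j k ≤ ∑ _j : Fin d, 1 :=
            Finset.sum_le_sum fun j _ => hybridProb_le_one Pr n hb0 hb1 j k
        _ = ENNReal.ofReal d := by simp
        _ ≤ _ := by
            refine ENNReal.ofReal_le_ofReal ?_
            have h1 : (d : ℝ) ≤ d * tailWeight n k :=
              le_mul_of_one_le_right (Nat.cast_nonneg d) (one_le_tailWeight h)
            have : 0 ≤ n * D := by positivity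
            linarith
  have hw : ∀ k, (2⁻¹ ^ n * n.choose k : ℝ≥0∞) = ENNReal.ofReal (2⁻¹ ^ n * n.choose k) := by
    intro k
    rw [ENNReal.ofReal_mul (by positivity), ENNReal.ofReal_pow (by positivity),
      ENNReal.ofReal_inv_of_pos two_pos, ENNReal.ofReal_ofNat, ENNReal.ofReal_natCast]
  have key : ENNReal.ofReal (d * (99 / 100)) ≤
      ENNReal.ofReal (1 + n * D + d * (1 / 4)) := by
    calc ENNReal.ofReal (d * (99 / 100)) = ∑ _j : Fin d, ENNReal.ofReal (99 / 100) := by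
          rw [ENNReal.ofReal_mul (Nat.cast_nonneg d)]; simp
      _ ≤ ∑ j, ∑ k ∈ Finset.range (n + 1), 2⁻¹ ^ n * n.choose k * hybridProb Pr n b j k :=
          Finset.sum_le_sum fun j _ => le_sum_choose_mul_hybridProb Pr hα hb hb1 hsel j
      _ = ∑ k ∈ Finset.range (n + 1), 2⁻¹ ^ n * n.choose k * ∑ j, hybridProb Pr n b j k := by
          rw [Finset.sum_comm]
          simp_rw [Finset.mul_sum]
      _ ≤ ∑ k ∈ Finset.range (n + 1), ENNReal.ofReal (2⁻¹ ^ n * n.choose k) *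
            ENNReal.ofReal (1 + n * D + d * tailWeight n k) := by
          refine Finset.sum_le_sum fun k hk => ?_
          rw [hw]
          gcongr
          exact hS k hk
      _ = ENNReal.ofReal (∑ k ∈ Finset.range (n + 1), 2⁻¹ ^ n * n.choose k *
            (1 + n * D + d * tailWeight n k)) := by
          rw [ENNReal.ofReal_sum_of_nonneg]
          · exact Finset.sum_congr rfl fun k _ => (ENNReal.ofReal_mul (by positivity)).symm
          · intro k _
            have := htail k
            positivity
      _ = _ := by
          congr 1
          have : ∀ k, (2⁻¹ ^ n * n.choose k * (1 + n * D + d * tailWeight n k) : ℝ) =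
              (1 + n * D) * (2⁻¹ ^ n * n.choose k) +
                d * (2⁻¹ ^ n * n.choose k * tailWeight n k) := fun k => by ring
          simp_rw [this]
          rw [Finset.sum_add_distrib, ← Finset.mul_sum _ _ (1 + n * D),
            ← Finset.mul_sum _ _ (d : ℝ), sum_choose_div_two_pow, sum_choose_mul_tailWeight,
            mul_one]
  exact (ENNReal.ofReal_le_ofReal_iff (by positivity)).1 key

/-- Since `d / δ ≥ 2`, the logarithm is at least `1 / 2`, so `δd ≤ α²ε² ≤ ε²`. Multiplying by `δ ≤
1` and by `d` gives `(δd)² ≤ ε²d`. -/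
lemma mul_dimension_le_of_mul_log_le {d : ℕ} (hd : 2 ≤ d) {α ε δ : ℝ} (hα : 0 < α) (hα' : α < 1 / 2)
    (hε : 0 < ε) (hδ : 0 ≤ δ) (hδ1 : δ ≤ 1)
    (h : δ * Real.log (d / δ) ≤ 1 / 2 * (α ^ 2 * ε ^ 2 / d)) : δ * d ≤ ε * √d := by
  rcases hδ.eq_or_lt with rfl | hδ0
  · rw [zero_mul]; positivity
  have hd2 : (2 : ℝ) ≤ d := by exact_mod_cast hd
  have hlog : 1 / 2 ≤ Real.log (d / δ) := by
    have h2 : (2 : ℝ) ≤ d / δ := by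
      rw [le_div_iff₀ hδ0]; nlinarith
    have := Real.log_le_log two_pos h2
    have := Real.log_two_gt_d9
    linarith
  have h1 : δ * (1 / 2) ≤ 1 / 2 * (α ^ 2 * ε ^ 2 / d) :=
    (mul_le_mul_of_nonneg_left hlog hδ).trans h
  have h2 : δ * d ≤ α ^ 2 * ε ^ 2 := by
    rw [← le_div_iff₀ (by linarith)]; linarith
  have h3 : α ^ 2 * ε ^ 2 ≤ ε ^ 2 :=
    mul_le_of_le_one_left (sq_nonneg ε) (pow_le_one₀ hα.le (by linarith))
  refine abs_le_of_sq_le_sq' ?_ (by positivity) |>.2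
  rw [mul_pow ε, Real.sq_sqrt (by linarith)]
  have h4 : δ * d * δ ≤ ε ^ 2 * 1 := mul_le_mul (h2.trans h3) hδ1 hδ (sq_nonneg ε)
  nlinarith

theorem mainTheorem5 :
    ∃ c : ℝ, 0 < c ∧ ∃ C : ℝ, 0 < C ∧
      ∀ (d : ℕ), 2 ≤ d → ∀ (α ε δ : ℝ), 0 < α → α < 1 / 2 → 0 < ε → 0 ≤ δ → δ ≤ 1 →
        δ * Real.log (d / δ) ≤ c * (α ^ 2 * ε ^ 2 / d) →
        ∀ (W Y : Type*) [MeasurableSpace W] [MeasurableSpace Y]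
          (Pr : ShuffleProtocol (Fin d → ℤˣ) W Y (Fin d)),
          Pr.IsRobustlyPrivate ε δ (1 / 3) →
          ∀ n : ℕ, SolvesSelection (Pr.output n) α →
            C * (Real.sqrt d / (α * ε)) ≤ n := by
  -- With `b ≤ 4α` and `δd ≤ ε√d`, each hybrid step costs at most `40αε√d`. As `1 ≤ d / 2`, what
  -- remains is `(0.99 - 0.5 - 0.25) d = 0.24 d ≤ 40 n α ε √d`, and `0.24 / 40 = 6 / 1000`.
  refine ⟨1 / 2, by norm_num, 6 / 1000, by norm_num, ?_⟩
  intro d hd α ε δ hα hα' hε hδ hδ1 h W Y _ _ Pr hPr n hsel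
  have hd2 : (2 : ℝ) ≤ d := by exact_mod_cast hd
  -- The cap at 1 keeps the weights nonnegative; the strict inequality survives it because `α < 1 /
  -- 2`.
  have hb : α < min (4 * α) 1 / 2 := by
    rw [lt_div_iff₀ two_pos, lt_min_iff]
    constructor <;> linarith
  have key := selection_dimension_le (by omega) Pr hα hε hδ hb (min_le_right _ _) hPr hsel
  have hδd := mul_dimension_le_of_mul_log_le hd hα hα' hε hδ hδ1 h
  have hs : 0 < √(d : ℝ) := by positivity
  have hD : min (4 * α) 1 * (8 * ε * √d + 2 * δ * d) ≤ 4 * α * (10 * (ε * √d)) := by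
    refine mul_le_mul (min_le_left _ _) (by linarith) (by positivity) (by positivity)
  have hD' := mul_le_mul_of_nonneg_left hD (Nat.cast_nonneg (α := ℝ) n)
  have hsq : √(d : ℝ) * √d = d := Real.mul_self_sqrt (by linarith)
  rw [← mul_div_assoc, div_le_iff₀ (by positivity)]
  have h1 : √(d : ℝ) * (6 / 1000 * √d) ≤ √d * (n * (α * ε)) := by
    have : √(d : ℝ) * (6 / 1000 * √d) = 6 / 1000 * d := by linear_combination (6 / 1000) * hsq
    rw [this]
    linarith
  exact le_of_mul_le_mul_left h1 hs

end
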